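/- Let $n\ge 1$, $\gamma>1$ and $s\ge 0$, and consider the viscoelastic damped wave equation with exponentially decaying memory $$u_{tt}-\Delta u-\Delta u_t+\int_0^t e^{-\gamma(t-\eta)}\,\Delta u(\eta,\cdot)\,d\eta=0\quad (x\in\mathbb R^n,\ t>0),\qquad (u,u_t)(0,\cdot)=(u_0,u_1).$$ Let $L^{1,1}(\mathbb R^n)$ be the space of functions with $\|f\|_{L^{1,1}}:=\int_{\mathbb R^n}(1+|x|)\,|f(x)|\,dx<\infty$, put $\|f\|_{H^s\cap L^{1,1}}:=\|f\|_{H^s}+\|f\|_{L^{1,1}}$ and $P_f:=\int_{\mathbb R^n}f(x)\,dx$, and let $|D|^s$ be the operator with Fourier symbol $|\xi|^s$. There is a constant $C>0$ depending only on $n$, $\gamma$ and $s$ such that for all $u_0,u_1\in H^s(\mathbb R^n)\cap L^{1,1}(\mathbb R^n)$ the Cauchy problem has a unique solution $u\in C^1([0,\infty),L^2(\mathbb R^n))$ (the equation being understood for every $t>0$ in the sense of tempered distributions in $x$), and for every $t\ge 0$ one has $|D|^su_t(t,\cdot)\in L^2(\mathbb R^n)$ and $$\begin{aligned}\big\||D|^su_t(t,\cdot)\big\|_{L^2}\le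 C\Big(&(1+t)^{-\frac{s+2}{2}-\frac n4}\|u_0\|_{H^s\cap L^{1,1}}+(1+t)^{-\frac{s+1}{2}-\frac n4}|P_{u_0}|\\&+(1+t)^{-\frac{s+1}{2}-\frac n4}\|u_1\|_{H^s\cap L^{1,1}}+(1+t)^{-\frac s2-\frac n4}|P_{u_1}|\Big).\end{aligned}$$ -/

import Mathlib

open MeasureTheory Set FourierTransform Laplacian TemperedDistribution
open scoped SchwartzMap ENNReal

namespace ViscoelasticMemory

noncomputable section

/-- `ℝⁿ` with its Euclidean norm. -/
abbrev Space (n : ℕ) : Type := EuclideanSpace ℝ (Fin n)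

/-- `L²(ℝⁿ)` (complex-valued; real-valued functions are a special case). -/
abbrev L2 (n : ℕ) : Type := Lp ℂ 2 (volume : Measure (Space n))

variable {n : ℕ}

/-- Membership of an `L²` function in the weighted space `L^{1,1}(ℝⁿ)`. -/
def MemL11 (f : L2 n) : Prop :=
  Integrable (fun x : Space n => (1 + ‖x‖) * ‖f x‖)

/-- The norm `∫ (1 + |x|) |f(x)| dx` of `L^{1,1}(ℝⁿ)`. -/
def normL11 (f : L2 n) : ℝ := ∫ x : Space n, (1 + ‖x‖) * ‖f x‖

/-- The mean `P_f = ∫ f(x) dx`. -/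
def mean (f : L2 n) : ℂ := ∫ x : Space n, f x

/-- Membership of an `L²` function in the Sobolev space `H^s(ℝⁿ)`. -/
def MemHs (s : ℝ) (f : L2 n) : Prop := MemSobolev s 2 (f : 𝓢'(Space n, ℂ))

open Classical in
/-- The norm of `H^s(ℝⁿ)`, that is, the `L²` norm of the Bessel potential of order `s` of `f`
(with the value `0` when `f` is not in `H^s`). -/
def normHs (s : ℝ) (f : L2 n) : ℝ := if h : MemHs s f then ‖h.choose‖ else 0

theorem normHs_eq {s : ℝ} {f g : L2 n}
    (h : besselPotential (Space n) ℂ s (f : 𝓢'(Space n, ℂ)) = (g : 𝓢'(Space n, ℂ))) :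
    normHs s f = ‖g‖ := by
  have hf : MemHs s f := ⟨g, h⟩
  have hg : hf.choose = g := by
    have h1 : Lp.toTemperedDistributionCLM ℂ volume 2 hf.choose
        = Lp.toTemperedDistributionCLM ℂ volume 2 g := by
      simpa using hf.choose_spec.symm.trans h
    exact LinearMap.ker_eq_bot.1 (Lp.ker_toTemperedDistributionCLM_eq_bot) h1
  rw [normHs, dif_pos hf, hg]

/-- The norm of `H^s(ℝⁿ) ∩ L^{1,1}(ℝⁿ)`. -/
def normHsL11 (s : ℝ) (f : L2 n) : ℝ := normHs s f + normL11 f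

/-- `g = |D|^s f` in `L²(ℝⁿ)`, where `|D|^s` is the operator with symbol `|ξ|^s`. The frequency
variable of Mathlib's Fourier transform is `ξ / (2π)`, so the symbol reads `(2π‖ξ‖)^s`. -/
def IsAbsDPow (s : ℝ) (f g : L2 n) : Prop :=
  ∀ᵐ ξ : Space n, (𝓕 g : L2 n) ξ = (((2 * Real.pi * ‖ξ‖) ^ s : ℝ) : ℂ) * (𝓕 f : L2 n) ξ

/-- The time derivative `u_t(t)` on `[0, ∞)` (one-sided at `t = 0`), in `L²(ℝⁿ)`. -/
def timeDeriv (u : ℝ → L2 n) (t : ℝ) : L2 n := derivWithin u (Ici 0) t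

/-- `u` solves `u_tt - Δu - Δu_t + g ∗ Δu = 0` for `t > 0` with `g(t) = exp(-γ t)`, and
`u(0) = u₀`, `u_t(0) = u₁`: it is of class `C¹([0, ∞), L²(ℝⁿ))`, takes the initial data, and
satisfies the equation for every `t > 0` when paired with any Schwartz function in space. The values
of `u` at negative times are irrelevant. -/
structure IsSolution (γ : ℝ) (u₀ u₁ : L2 n) (u : ℝ → L2 n) : Prop where
  contDiffOn : ContDiffOn ℝ 1 u (Ici 0)
  initial_value : u 0 = u₀
  initial_velocity : timeDeriv u 0 = u₁
  equation : ∀ (φ : 𝓢(Space n, ℂ)) (t : ℝ), 0 < t →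
    HasDerivAt (fun τ : ℝ => (timeDeriv u τ : 𝓢'(Space n, ℂ)) φ)
      ((Δ (u t : 𝓢'(Space n, ℂ))) φ + (Δ (timeDeriv u t : 𝓢'(Space n, ℂ))) φ
        - ∫ η in (0 : ℝ)..t,
            (Real.exp (-γ * (t - η)) : ℂ) * (Δ (u η : 𝓢'(Space n, ℂ))) φ) t

end

end ViscoelasticMemory

namespace ViscoelasticMemory


/-! After a Fourier transform in space the problem decouples into ordinary equations indexed by r =
|ξ|². The memory is made local by the relative history z = w/γ − ∫ exp(−γ(t−η)) w(η) dη, which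
relaxes: z' = v/γ − γz. With k = 1 − 1/γ > 0 the mode becomes w' = v, v' = −r(kw + v + z), and the
energy v² + r(kw² + γz²) is dissipated. A Lyapunov correction in vw gives exponential decay at a
rate proportional to min(1, r) (`IsMode.energy_decay`).

For r ≤ 1 the velocity multiplier squared is at most a constant times exp(−crt), with a further
factor r on the u₀ part. Weighted data satisfy |û(ξ) − P_u| ≤ |ξ| ‖u‖_{L^{1,1}}, so the squared L²
norm is bounded by Gaussian moments in ξ, whose scaling in 1 + t produces the rates. For r ≥ 1
everything decays exponentially, uniformly in r, and the H^s norm suffices without loss of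
derivatives (`IsMode.velocity_sq_le_of_one_le`).

Existence: superposing the two fundamental modes in frequency gives a C¹ curve in L² by dominated
convergence; the equation holds after pairing, with |ξ|² moved to the test function. Uniqueness: the
difference of two solutions satisfies the time-integrated equation; on {|ξ|² ≤ M} the Laplacian is
bounded, so Grönwall applies, and M is arbitrary. -/

/-! ### Energy estimates at a single frequency -/

/-- A differential inequality `f' ≤ -c f` on `[0, ∞)` gives exponential decay. -/
theorem le_exp_mul_of_deriv_le {f f' : ℝ → ℝ} {c : ℝ} (hf : ∀ t, HasDerivAt f (f' t) t)
    (h : ∀ t, 0 ≤ t → f' t ≤ -c * f t) {t : ℝ} (ht : 0 ≤ t) :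
    f t ≤ Real.exp (-c * t) * f 0 := by
  have hg : ∀ t, HasDerivAt (fun t => Real.exp (c * t) * f t)
      (Real.exp (c * t) * (c * 1) * f t + Real.exp (c * t) * f' t) t := fun t =>
    (((hasDerivAt_id t).const_mul c).exp).mul (hf t)
  have hanti : AntitoneOn (fun t => Real.exp (c * t) * f t) (Ici 0) := by
    refine antitoneOn_of_deriv_nonpos (convex_Ici 0)
      (fun t _ => (hg t).continuousAt.continuousWithinAt)
      (fun t _ => (hg t).differentiableAt.differentiableWithinAt) (fun t ht => ?_)
    rw [interior_Ici] at ht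
    rw [(hg t).deriv]
    have h1 := h t (le_of_lt ht)
    nlinarith [Real.exp_pos (c * t)]
  have h0 := hanti (mem_Ici.2 le_rfl) (mem_Ici.2 ht) ht
  simp only [mul_zero, Real.exp_zero, one_mul] at h0
  calc f t = Real.exp (-c * t) * (Real.exp (c * t) * f t) := by
        rw [← mul_assoc, ← Real.exp_add]; simp
    _ ≤ _ := by gcongr

/-- The equation at a frequency with `|ξ|² = r`, written as a first order system for the
amplitude `w`, its velocity `v` and the relative history `z = w / γ - ∫ exp(-γ (t - η)) w(η) dη`. -/
structure IsMode (γ r : ℝ) (w v z : ℝ → ℝ) : Prop where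
  hw : ∀ t, HasDerivAt w (v t) t
  hv : ∀ t, HasDerivAt v (-(r * ((1 - γ⁻¹) * w t + v t + z t))) t
  hz : ∀ t, HasDerivAt z (γ⁻¹ * v t - γ * z t) t

namespace IsMode

variable {γ r : ℝ} {w v z : ℝ → ℝ}

/-- The energy has derivative −2rv² − 2rγ²z², which does not see w. Adding kρ(vw + rw²/2) supplies
the missing −k²ρrw²; the term rw²/2 cancels the −rvw produced by the damping. The constraint ρ ≤
min(1, r) keeps the corrected functional within a factor 2 of the energy in both directions, whence
the constant 4. -/
theorem energy_decay (h : IsMode γ r w v z) (hγ : 1 < γ) {ρ : ℝ} (hρ : 0 ≤ ρ) (hρ1 : ρ ≤ 1)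
    (hρr : ρ ≤ r) {t : ℝ} (ht : 0 ≤ t) :
    v t ^ 2 + r * ((1 - γ⁻¹) * w t ^ 2 + γ * z t ^ 2) ≤
      4 * Real.exp (-((1 - γ⁻¹) / 4 * ρ) * t) *
        (v 0 ^ 2 + r * ((1 - γ⁻¹) * w 0 ^ 2 + γ * z 0 ^ 2)) := by
  have hγ0 : 0 < γ := by linarith
  have hi : γ * γ⁻¹ = 1 := mul_inv_cancel₀ hγ0.ne'
  have hi0 : 0 < γ⁻¹ := by positivity
  have hk0 : 0 < 1 - γ⁻¹ := by have := inv_lt_one_of_one_lt₀ hγ; linarith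
  have hk1 : 1 - γ⁻¹ < 1 := by linarith
  set k : ℝ := 1 - γ⁻¹ with hk
  have hr : 0 ≤ r := hρ.trans hρr
  set L : ℝ → ℝ := fun t => v t * v t + r * (k * (w t * w t) + γ * (z t * z t))
    + k * ρ * (v t * w t + r / 2 * (w t * w t)) with hL
  have hd : ∀ t, HasDerivAt L (-2 * r * v t ^ 2 - 2 * r * γ ^ 2 * z t ^ 2
      + k * ρ * (v t ^ 2 - r * k * w t ^ 2 - r * z t * w t)) t := fun t => by
    have H := ((((h.hv t).mul (h.hv t)).add (((((h.hw t).mul (h.hw t)).const_mul k).add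
      (((h.hz t).mul (h.hz t)).const_mul γ)).const_mul r)).add
      ((((h.hv t).mul (h.hw t)).add (((h.hw t).mul (h.hw t)).const_mul (r / 2))).const_mul (k * ρ)))
    refine H.congr_deriv ?_
    linear_combination (2 * r * v t * z t) * hi
  have hlow : ∀ t, v t ^ 2 + r * (k * w t ^ 2 + γ * z t ^ 2) ≤ 2 * L t := fun t => by
    have h1 : k * ρ * (k * ρ) ≤ r * k := by
      have : ρ * ρ ≤ r := by nlinarith
      calc k * ρ * (k * ρ) = (k * k) * (ρ * ρ) := by ring
        _ ≤ k * r := by gcongr; nlinarith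
        _ = r * k := mul_comm _ _
    have h2 : k * ρ * (k * ρ) * w t ^ 2 ≤ r * k * w t ^ 2 := by gcongr
    have h3 : 0 ≤ k * ρ * (r * w t ^ 2) := by positivity
    have h4 : 0 ≤ r * (γ * z t ^ 2) := by positivity
    simp only [hL]
    nlinarith [sq_nonneg (v t + k * ρ * w t)]
  have hup : ∀ t, L t ≤ 2 * (v t ^ 2 + r * (k * w t ^ 2 + γ * z t ^ 2)) := fun t => by
    have h1 : k * ρ * (k * ρ) ≤ r * k := by
      have : ρ * ρ ≤ r := by nlinarith
      calc k * ρ * (k * ρ) = (k * k) * (ρ * ρ) := by ring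
        _ ≤ k * r := by gcongr; nlinarith
        _ = r * k := mul_comm _ _
    have h2 : k * ρ * (k * ρ) * w t ^ 2 ≤ r * k * w t ^ 2 := by gcongr
    have h3 : k * ρ * (r * w t ^ 2) ≤ k * 1 * (r * w t ^ 2) := by gcongr
    have h4 : 0 ≤ r * (γ * z t ^ 2) := by positivity
    simp only [hL]
    nlinarith [sq_nonneg (v t - k * ρ * w t), sq_nonneg (v t)]
  have hdec := le_exp_mul_of_deriv_le (c := k / 4 * ρ) hd (fun t _ => by
    have h0 := hup t
    have h1 : k / 4 * ρ * L t ≤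
        k / 4 * ρ * (2 * (v t ^ 2 + r * (k * w t ^ 2 + γ * z t ^ 2))) := by gcongr
    have hkρ : k * ρ ≤ r := by nlinarith
    have a1 : k * ρ * v t ^ 2 ≤ r * v t ^ 2 := by gcongr
    have a2 : k * ρ * (γ * (r * z t ^ 2)) ≤ 1 * 1 * (γ * (r * z t ^ 2)) := by gcongr
    have a3 : 1 * (γ * (r * z t ^ 2)) ≤ γ * (γ * (r * z t ^ 2)) := by gcongr
    have a4 : -(k * ρ * (r * z t * w t)) ≤ ρ * r * (k ^ 2 * w t ^ 2 / 2 + z t ^ 2 / 2) := by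
      have : 0 ≤ ρ * r * (k * w t + z t) ^ 2 := by positivity
      nlinarith
    have a5 : ρ * (r * z t ^ 2) ≤ 1 * (r * z t ^ 2) := by gcongr
    have a6 : 1 * 1 * (r * z t ^ 2) ≤ γ * γ * (r * z t ^ 2) := by gcongr
    nlinarith) ht
  calc _ ≤ 2 * L t := hlow t
    _ ≤ 2 * (Real.exp (-(k / 4 * ρ) * t) * L 0) := by gcongr
    _ ≤ 2 * (Real.exp (-(k / 4 * ρ) * t) *
          (2 * (v 0 ^ 2 + r * (k * w 0 ^ 2 + γ * z 0 ^ 2)))) := by gcongr; exact hup 0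
    _ = _ := by ring

/-- The initial energy may be of size r. Dividing by r bounds kw² + γz² uniformly, but leaves v²
with a factor r. That factor is removed by reading v' = −rv − r(kw + z) as damping at rate r, which
absorbs a forcing proportional to r. -/
theorem velocity_sq_le_of_one_le (h : IsMode γ r w v z) (hγ : 1 < γ) (hr : 1 ≤ r)
    (h0 : v 0 ^ 2 + ((1 - γ⁻¹) * w 0 ^ 2 + γ * z 0 ^ 2) ≤ 1) {t : ℝ} (ht : 0 ≤ t) :
    v t ^ 2 ≤ 17 * Real.exp (-((1 - γ⁻¹) / 4) * t) := by
  have hγ0 : 0 < γ := by linarith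
  have hi0 : 0 < γ⁻¹ := by positivity
  have hk0 : 0 < 1 - γ⁻¹ := by have := inv_lt_one_of_one_lt₀ hγ; linarith
  have hk1 : 1 - γ⁻¹ < 1 := by linarith
  have hE : ∀ t, 0 ≤ t → (1 - γ⁻¹) * w t ^ 2 + γ * z t ^ 2 ≤
      4 * Real.exp (-((1 - γ⁻¹) / 4) * t) := fun t ht => by
    have H := h.energy_decay hγ zero_le_one le_rfl hr ht
    rw [mul_one] at H
    set e := Real.exp (-((1 - γ⁻¹) / 4) * t)
    have he : 0 < e := Real.exp_pos _
    have h1 : v 0 ^ 2 + r * ((1 - γ⁻¹) * w 0 ^ 2 + γ * z 0 ^ 2) ≤ r * 1 := by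
      nlinarith [sq_nonneg (v 0)]
    have h2 := mul_le_mul_of_nonneg_left h1 (by positivity : 0 ≤ 4 * e)
    have h3 : r * ((1 - γ⁻¹) * w t ^ 2 + γ * z t ^ 2) ≤ r * (4 * e) := by
      nlinarith [sq_nonneg (v t)]
    exact le_of_mul_le_mul_left h3 (by linarith)
  set k : ℝ := 1 - γ⁻¹ with hk
  -- Since (kw + z)² ≤ 8e, the forcing contributes at most 8re, and differentiating the exponential
  -- at most 8re more. So v² − 16e decays at rate r, and 17 = 16 + 1 accounts for v(0)² ≤ 1.
  have hd : ∀ t, HasDerivAt (fun t => v t * v t - 16 * Real.exp (-(k / 4) * t))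
      (-(r * (k * w t + v t + z t)) * v t + v t * -(r * (k * w t + v t + z t))
        - 16 * (Real.exp (-(k / 4) * t) * (-(k / 4) * 1))) t := fun t =>
    ((h.hv t).mul (h.hv t)).sub ((((hasDerivAt_id t).const_mul (-(k / 4))).exp).const_mul 16)
  have hdec := le_exp_mul_of_deriv_le (c := r) hd (fun t ht => by
    have h1 := hE t ht
    have he : 0 < Real.exp (-(k / 4) * t) := Real.exp_pos _
    set e := Real.exp (-(k / 4) * t)
    have h2 : (k * w t + z t) ^ 2 ≤ 8 * e := by
      have : k ^ 2 * w t ^ 2 ≤ k * w t ^ 2 := by gcongr; nlinarith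
      have : 1 * z t ^ 2 ≤ γ * z t ^ 2 := by gcongr
      nlinarith [sq_nonneg (k * w t - z t)]
    have h3 : r * (k * w t + z t) ^ 2 ≤ r * (8 * e) := by gcongr
    have h4 : 0 ≤ r * (v t + (k * w t + z t)) ^ 2 := by positivity
    have h5 : 16 * (e * (k / 4)) ≤ 8 * (r * e) := by nlinarith
    nlinarith) ht
  have hle : Real.exp (-r * t) ≤ Real.exp (-(k / 4) * t) := by
    apply Real.exp_le_exp.2; nlinarith
  have hv0 : v 0 ^ 2 ≤ 1 := by
    have : 0 ≤ k * w 0 ^ 2 := by positivity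
    have : 0 ≤ γ * z 0 ^ 2 := by positivity
    linarith
  simp only [mul_zero, Real.exp_zero] at hdec
  have : Real.exp (-r * t) * (v 0 * v 0 - 16 * 1) ≤ Real.exp (-r * t) * 1 := by
    gcongr; nlinarith
  nlinarith

theorem velocity_sq_le (h : IsMode γ r w v z) (hγ : 1 < γ) (hr : 0 ≤ r)
    (h0 : v 0 ^ 2 + ((1 - γ⁻¹) * w 0 ^ 2 + γ * z 0 ^ 2) ≤ 1) {t : ℝ} (ht : 0 ≤ t) :
    v t ^ 2 ≤ 17 := by
  have hγ0 : 0 < γ := by linarith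
  have hk0 : 0 < 1 - γ⁻¹ := by have := inv_lt_one_of_one_lt₀ hγ; linarith
  rcases le_total 1 r with h1 | h1
  · have H := h.velocity_sq_le_of_one_le hγ h1 h0 ht
    have : Real.exp (-((1 - γ⁻¹) / 4) * t) ≤ 1 := by
      apply Real.exp_le_one_iff.2; nlinarith
    linarith
  -- With ρ = 0 this is boundedness of the energy, whose initial value is at most 1 because r ≤ 1.
  · have H := h.energy_decay hγ le_rfl zero_le_one hr ht
    simp only [mul_zero, neg_zero, zero_mul, Real.exp_zero] at H
    have a1 : 0 ≤ r * ((1 - γ⁻¹) * w t ^ 2 + γ * z t ^ 2) := by positivity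
    have a2 : r * ((1 - γ⁻¹) * w 0 ^ 2 + γ * z 0 ^ 2) ≤
        1 * ((1 - γ⁻¹) * w 0 ^ 2 + γ * z 0 ^ 2) := by gcongr
    linarith

theorem abs_velocity_le (h : IsMode γ r w v z) (hγ : 1 < γ) (hr : 0 ≤ r)
    (h0 : v 0 ^ 2 + ((1 - γ⁻¹) * w 0 ^ 2 + γ * z 0 ^ 2) ≤ 1) {t : ℝ} (ht : 0 ≤ t) :
    |v t| ≤ 5 := by
  have := h.velocity_sq_le hγ hr h0 ht
  exact abs_le_of_sq_le_sq (by linarith) (by norm_num)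

/-- The energy weights z² by r and gives nothing as r → 0. Instead z relaxes at rate γ under the
forcing v/γ, so v² ≤ 17 makes z² − 17 decay at rate γ. -/
theorem abs_history_le (h : IsMode γ r w v z) (hγ : 1 < γ) (hr : 0 ≤ r)
    (h0 : v 0 ^ 2 + ((1 - γ⁻¹) * w 0 ^ 2 + γ * z 0 ^ 2) ≤ 1) {t : ℝ} (ht : 0 ≤ t) :
    |z t| ≤ 5 := by
  have hγ0 : 0 < γ := by linarith
  have hi : γ * γ⁻¹ = 1 := mul_inv_cancel₀ hγ0.ne'
  have hk0 : 0 < 1 - γ⁻¹ := by have := inv_lt_one_of_one_lt₀ hγ; linarith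
  have hd : ∀ t, HasDerivAt (fun t => z t * z t - 17)
      ((γ⁻¹ * v t - γ * z t) * z t + z t * (γ⁻¹ * v t - γ * z t)) t := fun t =>
    ((h.hz t).mul (h.hz t)).sub_const 17
  have hdec := le_exp_mul_of_deriv_le (c := γ) hd (fun t ht => by
    have h1 := h.velocity_sq_le hγ hr h0 ht
    have h2 : 0 ≤ γ * (γ⁻¹ * (γ⁻¹ * v t) - z t) ^ 2 := by positivity
    have h3 : γ * (γ⁻¹ * (γ⁻¹ * v t)) ^ 2 ≤ γ * 17 := by
      have : (γ⁻¹ * (γ⁻¹ * v t)) ^ 2 = (γ⁻¹ * γ⁻¹) ^ 2 * v t ^ 2 := by ring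
      have h5 : γ⁻¹ * γ⁻¹ ≤ 1 := by nlinarith [inv_pos.2 hγ0]
      have h4 : (γ⁻¹ * γ⁻¹) ^ 2 ≤ 1 := pow_le_one₀ (by positivity) h5
      have h6 : (γ⁻¹ * γ⁻¹) ^ 2 * v t ^ 2 ≤ 1 * 17 := by gcongr
      rw [this]; gcongr; linarith
    have h4 : γ * (γ⁻¹ * (γ⁻¹ * v t)) = γ⁻¹ * v t := by
      linear_combination (γ⁻¹ * v t) * hi
    have h5 : γ * (γ⁻¹ * (γ⁻¹ * v t)) * z t = γ⁻¹ * v t * z t := by rw [h4]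
    nlinarith) ht
  have hz0 : z 0 ^ 2 ≤ 1 := by
    have : 0 ≤ (1 - γ⁻¹) * w 0 ^ 2 := by positivity
    have : 1 * z 0 ^ 2 ≤ γ * z 0 ^ 2 := by gcongr
    nlinarith [sq_nonneg (v 0)]
  have h1 : Real.exp (-γ * t) * (z 0 * z 0 - 17) ≤ 0 :=
    mul_nonpos_of_nonneg_of_nonpos (Real.exp_pos _).le (by nlinarith)
  refine abs_le_of_sq_le_sq ?_ (by norm_num)
  nlinarith

/-- Integrates the velocity bound. Linear growth is harmless: only a bound uniform in r and locally
bounded in time is used. -/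
theorem abs_amplitude_le (h : IsMode γ r w v z) (hγ : 1 < γ) (hr : 0 ≤ r)
    (h0 : v 0 ^ 2 + ((1 - γ⁻¹) * w 0 ^ 2 + γ * z 0 ^ 2) ≤ 1) {t : ℝ} (ht : 0 ≤ t) :
    |w t| ≤ |w 0| + 5 * t := by
  have H := norm_image_sub_le_of_norm_deriv_le_segment' (f := w) (f' := v) (C := 5) (a := 0) (b := t)
    (fun x _ => (h.hw x).hasDerivWithinAt)
    (fun x hx => h.abs_velocity_le hγ hr h0 hx.1) t ⟨ht, le_rfl⟩
  rw [Real.norm_eq_abs, sub_zero] at H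
  have := abs_sub_abs_le_abs_sub (w t) (w 0)
  linarith

end IsMode

/-! ### The flow of one mode and its dependence on r -/

/-- The generator of the first order system at a frequency with `|ξ|² = r`. -/
noncomputable def modeGen (γ r : ℝ) : (ℝ × ℝ × ℝ) →L[ℝ] (ℝ × ℝ × ℝ) :=
  let W := ContinuousLinearMap.fst ℝ ℝ (ℝ × ℝ)
  let V := (ContinuousLinearMap.fst ℝ ℝ ℝ).comp (ContinuousLinearMap.snd ℝ ℝ (ℝ × ℝ))
  let Z := (ContinuousLinearMap.snd ℝ ℝ ℝ).comp (ContinuousLinearMap.snd ℝ ℝ (ℝ × ℝ))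
  V.prod ((0 : (ℝ × ℝ × ℝ) →L[ℝ] ℝ).prod (γ⁻¹ • V - γ • Z))
    + r • (0 : (ℝ × ℝ × ℝ) →L[ℝ] ℝ).prod ((-((1 - γ⁻¹) • W + V + Z)).prod 0)

theorem modeGen_apply (γ r : ℝ) (x : ℝ × ℝ × ℝ) :
    modeGen γ r x = (x.2.1, -(r * ((1 - γ⁻¹) * x.1 + x.2.1 + x.2.2)), γ⁻¹ * x.2.1 - γ * x.2.2) := by
  simp [modeGen]
  ring

theorem continuous_modeGen (γ : ℝ) : Continuous (modeGen γ) := by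
  unfold modeGen
  fun_prop

/-- The flow of the first order system at a frequency with `|ξ|² = r`. -/
noncomputable def modeFlow (γ r t : ℝ) (x : ℝ × ℝ × ℝ) : ℝ × ℝ × ℝ :=
  NormedSpace.exp (t • modeGen γ r) x

theorem modeFlow_zero (γ r : ℝ) (x : ℝ × ℝ × ℝ) : modeFlow γ r 0 x = x := by
  simp [modeFlow]

/-- The generator is affine in r. Continuity in r is what makes the Fourier multipliers measurable
in ξ. -/
theorem continuous_modeFlow (γ t : ℝ) (x : ℝ × ℝ × ℝ) : Continuous fun r => modeFlow γ r t x := by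
  have h1 : Continuous fun r => t • modeGen γ r := (continuous_modeGen γ).const_smul t
  let _ := NormedAlgebra.restrictScalars ℚ ℝ ((ℝ × ℝ × ℝ) →L[ℝ] (ℝ × ℝ × ℝ))
  have h2 : Continuous fun r => NormedSpace.exp (t • modeGen γ r) :=
    NormedSpace.exp_continuous.comp h1
  exact h2.clm_apply continuous_const

theorem hasDerivAt_modeFlow (γ r t : ℝ) (x : ℝ × ℝ × ℝ) :
    HasDerivAt (fun t => modeFlow γ r t x) (modeGen γ r (modeFlow γ r t x)) t := by
  have h := hasDerivAt_exp_smul_const' (𝕂 := ℝ) (modeGen γ r) t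
  exact h.clm_apply (hasDerivAt_const t x) |>.congr_deriv (by simp [modeFlow])

theorem isMode_modeFlow (γ r : ℝ) (x : ℝ × ℝ × ℝ) :
    IsMode γ r (fun t => (modeFlow γ r t x).1) (fun t => (modeFlow γ r t x).2.1)
      (fun t => (modeFlow γ r t x).2.2) where
  hw t := ((ContinuousLinearMap.fst ℝ ℝ (ℝ × ℝ)).hasFDerivAt.comp_hasDerivAt t
    (hasDerivAt_modeFlow γ r t x)).congr_deriv (by simp [modeGen_apply])
  hv t := (((ContinuousLinearMap.fst ℝ ℝ ℝ).comp
    (ContinuousLinearMap.snd ℝ ℝ (ℝ × ℝ))).hasFDerivAt.comp_hasDerivAt t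
    (hasDerivAt_modeFlow γ r t x)).congr_deriv (by simp [modeGen_apply])
  hz t := (((ContinuousLinearMap.snd ℝ ℝ ℝ).comp
    (ContinuousLinearMap.snd ℝ ℝ (ℝ × ℝ))).hasFDerivAt.comp_hasDerivAt t
    (hasDerivAt_modeFlow γ r t x)).congr_deriv (by simp [modeGen_apply])

variable {n : ℕ}


/-! ### Symbols, pairings and the Fourier transform on L² -/

/-- The symbol `|ξ|²` of `-Δ` in Mathlib's normalization of the frequency variable. -/
noncomputable def freqSq (ξ : Space n) : ℝ := (2 * Real.pi * ‖ξ‖) ^ 2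

theorem freqSq_nonneg (ξ : Space n) : 0 ≤ freqSq ξ := sq_nonneg _

theorem continuous_freqSq : Continuous (freqSq : Space n → ℝ) := by
  unfold freqSq; fun_prop

theorem hasTemperateGrowth_freqSq :
    (fun ξ : Space n => ((freqSq ξ : ℝ) : ℂ)).HasTemperateGrowth := by
  have : (fun ξ : Space n => ((freqSq ξ : ℝ) : ℂ)) =
      fun ξ => (((2 * Real.pi) ^ 2 : ℝ) : ℂ) * ((‖ξ‖ ^ 2 : ℝ) : ℂ) := by
    ext ξ; simp only [freqSq]; push_cast; ring
  rw [this]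
  fun_prop

theorem ae_eq_zero_of_integral_schwartz_eq_zero {g : Space n → ℂ} (hg : LocallyIntegrable g)
    (h : ∀ ψ : 𝓢(Space n, ℂ), ∫ ξ, ψ ξ * g ξ = 0) : g =ᵐ[volume] 0 := by
  refine ae_eq_zero_of_integral_contDiff_smul_eq_zero hg fun ψ hψ hc => ?_
  have hg₁ : HasCompactSupport (Complex.ofRealCLM ∘ ψ) := hc.comp_left rfl
  have hg₂ : ContDiff ℝ ((⊤ : ℕ∞) : WithTop ℕ∞) (Complex.ofRealCLM ∘ ψ) := by fun_prop
  simpa using h (hg₁.toSchwartzMap hg₂)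

theorem locallyIntegrable_L2 (f : L2 n) : LocallyIntegrable (f : Space n → ℂ) :=
  (Lp.memLp f).locallyIntegrable (by norm_num)

theorem integrable_schwartz_mul (ψ : 𝓢(Space n, ℂ)) (f : L2 n) :
    Integrable fun ξ => ψ ξ * f ξ :=
  (ψ.memLp 2).integrable_mul (Lp.memLp f)

/-- The pairing of `L²` functions with a Schwartz function, as a functional on `L²`. -/
noncomputable def pairCLM (φ : 𝓢(Space n, ℂ)) : L2 n →L[ℂ] ℂ where
  toFun f := (f : 𝓢'(Space n, ℂ)) φ
  map_add' f g := by
    change (Lp.toTemperedDistributionCLM ℂ volume 2 (f + g)) φ = _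
    rw [map_add]; rfl
  map_smul' c f := by
    change (Lp.toTemperedDistributionCLM ℂ volume 2 (c • f)) φ = _
    rw [map_smul]; rfl
  cont := (PointwiseConvergenceCLM.evalCLM (RingHom.id ℂ) ℂ φ).continuous.comp
    (Lp.toTemperedDistributionCLM ℂ volume 2).continuous

theorem pairCLM_apply (φ : 𝓢(Space n, ℂ)) (f : L2 n) :
    pairCLM φ f = (f : 𝓢'(Space n, ℂ)) φ := rfl

theorem laplacian_pairing (φ : 𝓢(Space n, ℂ)) (f : L2 n) :
    (Δ (f : 𝓢'(Space n, ℂ))) φ = pairCLM (Δ φ) f :=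
  TemperedDistribution.laplacian_apply_apply _ _

theorem pairing_fourier (φ : 𝓢(Space n, ℂ)) (f : L2 n) :
    (f : 𝓢'(Space n, ℂ)) φ = ∫ ξ, (𝓕⁻ φ : 𝓢(Space n, ℂ)) ξ * (𝓕 f : L2 n) ξ := by
  calc (f : 𝓢'(Space n, ℂ)) φ = (f : 𝓢'(Space n, ℂ)) (𝓕 (𝓕⁻ φ)) := by
        rw [fourier_fourierInv_eq]
    _ = (𝓕 (f : 𝓢'(Space n, ℂ))) (𝓕⁻ φ) := rfl
    _ = _ := by
        rw [Lp.fourier_toTemperedDistribution_eq, Lp.toTemperedDistribution_apply]; rfl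

theorem laplacian_pairing_fourier (φ : 𝓢(Space n, ℂ)) (f : L2 n) :
    (Δ (f : 𝓢'(Space n, ℂ))) φ =
      ∫ ξ, (𝓕⁻ φ : 𝓢(Space n, ℂ)) ξ * (-((freqSq ξ : ℝ) : ℂ) * (𝓕 f : L2 n) ξ) := by
  have hT : (fun x : Space n => Complex.ofReal (‖x‖ ^ 2)).HasTemperateGrowth := by fun_prop
  rw [TemperedDistribution.laplacian_eq_fourierMultiplierCLM]
  change (-(2 * Real.pi) ^ 2 : ℝ) • (TemperedDistribution.fourierMultiplierCLM ℂ
    (fun x : Space n => Complex.ofReal (‖x‖ ^ 2)) (f : 𝓢'(Space n, ℂ))) φ = _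
  rw [TemperedDistribution.fourierMultiplierCLM_apply_apply, pairing_fourier,
    fourierInv_fourier_eq, ← integral_smul]
  refine integral_congr_ae (Filter.Eventually.of_forall fun ξ => ?_)
  simp only [SchwartzMap.smulLeftCLM_apply_apply hT, smul_eq_mul, freqSq, Complex.real_smul]
  push_cast
  ring

/-- Testing with 𝓕ψ turns both pairings into integrals against ψ itself, and Schwartz functions
separate locally integrable functions. -/
theorem ae_fourier_eq_of_eq_laplacian {f g : L2 n}
    (h : ∀ φ : 𝓢(Space n, ℂ), (f : 𝓢'(Space n, ℂ)) φ = (Δ (g : 𝓢'(Space n, ℂ))) φ) :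
    ∀ᵐ ξ : Space n, (𝓕 f : L2 n) ξ = -((freqSq ξ : ℝ) : ℂ) * (𝓕 g : L2 n) ξ := by
  have hc : Continuous fun ξ : Space n => -((freqSq ξ : ℝ) : ℂ) :=
    (Complex.continuous_ofReal.comp continuous_freqSq).neg
  have hl : LocallyIntegrable fun ξ : Space n => -((freqSq ξ : ℝ) : ℂ) * (𝓕 g : L2 n) ξ :=
    (locallyIntegrable_L2 (𝓕 g : L2 n)).continuous_smul hc
  have := ae_eq_zero_of_integral_schwartz_eq_zero ((locallyIntegrable_L2 (𝓕 f : L2 n)).sub hl)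
    (fun ψ => by
      have H := h (𝓕 ψ)
      rw [pairing_fourier, laplacian_pairing_fourier, fourierInv_fourier_eq] at H
      -- The factor |ξ|² is moved onto ψ, which stays Schwartz.
      have hi : Integrable fun ξ : Space n => ψ ξ * (-((freqSq ξ : ℝ) : ℂ) * (𝓕 g : L2 n) ξ) := by
        have := (integrable_schwartz_mul
          (SchwartzMap.smulLeftCLM ℂ (fun ξ : Space n => ((freqSq ξ : ℝ) : ℂ)) ψ) (𝓕 g : L2 n)).neg
        refine this.congr (Filter.Eventually.of_forall fun ξ => ?_)
        simp only [Pi.neg_apply, SchwartzMap.smulLeftCLM_apply_apply hasTemperateGrowth_freqSq,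
          smul_eq_mul]
        ring
      simp only [Pi.sub_apply, mul_sub]
      rw [integral_sub (integrable_schwartz_mul ψ _) hi, H, sub_self])
  filter_upwards [this] with ξ hξ
  exact sub_eq_zero.1 hξ

theorem ae_fourier_eq_of_besselPotential_eq {s : ℝ} {f h : L2 n}
    (H : besselPotential (Space n) ℂ s (f : 𝓢'(Space n, ℂ)) = (h : 𝓢'(Space n, ℂ))) :
    ∀ᵐ ξ : Space n, (𝓕 h : L2 n) ξ =
      (((1 + ‖ξ‖ ^ 2) ^ (s / 2) : ℝ) : ℂ) * (𝓕 f : L2 n) ξ := by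
  have hT : (fun ξ : Space n => (((1 + ‖ξ‖ ^ 2) ^ (s / 2) : ℝ) : ℂ)).HasTemperateGrowth := by
    fun_prop
  have hc : Continuous fun ξ : Space n => (((1 + ‖ξ‖ ^ 2) ^ (s / 2) : ℝ) : ℂ) := hT.1.continuous
  have hl : LocallyIntegrable fun ξ : Space n =>
      (((1 + ‖ξ‖ ^ 2) ^ (s / 2) : ℝ) : ℂ) * (𝓕 f : L2 n) ξ :=
    (locallyIntegrable_L2 (𝓕 f : L2 n)).continuous_smul hc
  have H2 := congrArg (fun T : 𝓢'(Space n, ℂ) => 𝓕 T) H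
  simp only [fourier_besselPotential_eq_smulLeftCLM_fourier_apply,
    Lp.fourier_toTemperedDistribution_eq] at H2
  have := ae_eq_zero_of_integral_schwartz_eq_zero ((locallyIntegrable_L2 (𝓕 h : L2 n)).sub hl)
    (fun ψ => by
      have H3 := DFunLike.congr_fun H2 ψ
      rw [TemperedDistribution.smulLeftCLM_apply_apply, Lp.toTemperedDistribution_apply,
        Lp.toTemperedDistribution_apply] at H3
      have hi := integrable_schwartz_mul (SchwartzMap.smulLeftCLM ℂ
        (fun ξ : Space n => (((1 + ‖ξ‖ ^ 2) ^ (s / 2) : ℝ) : ℂ)) ψ) (𝓕 f : L2 n)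
      simp only [SchwartzMap.smulLeftCLM_apply_apply hT, smul_eq_mul] at H3 hi
      have e : ∀ ξ : Space n, ψ ξ * ((((1 + ‖ξ‖ ^ 2) ^ (s / 2) : ℝ) : ℂ) * (𝓕 f : L2 n) ξ) =
          (((1 + ‖ξ‖ ^ 2) ^ (s / 2) : ℝ) : ℂ) * ψ ξ * (𝓕 f : L2 n) ξ := fun ξ => by ring
      simp only [Pi.sub_apply, mul_sub, e]
      rw [integral_sub (integrable_schwartz_mul ψ _) hi, H3, sub_self])
  filter_upwards [this] with ξ hξ
  exact sub_eq_zero.1 hξ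

/-- Both transforms have the same pairing with every ψ: the L² one by the distributional definition,
the integral one by Fubini. -/
theorem ae_fourier_eq_fourierIntegral {f : L2 n} (hf : Integrable (f : Space n → ℂ)) :
    ∀ᵐ ξ : Space n, (𝓕 f : L2 n) ξ = 𝓕 (f : Space n → ℂ) ξ := by
  have hcont : Continuous (𝓕 (f : Space n → ℂ)) :=
    VectorFourier.fourierIntegral_continuous Real.continuous_fourierChar
      (L := innerₗ (Space n)) continuous_inner hf
  have hbound : ∀ ξ, ‖𝓕 (f : Space n → ℂ) ξ‖ ≤ ∫ x, ‖f x‖ := fun ξ =>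
    VectorFourier.norm_fourierIntegral_le_integral_norm Real.fourierChar volume
      (innerₗ (Space n)) f ξ
  have := ae_eq_zero_of_integral_schwartz_eq_zero
    ((locallyIntegrable_L2 (𝓕 f : L2 n)).sub hcont.locallyIntegrable) (fun ψ => by
      have H1 := pairing_fourier (𝓕 ψ) f
      rw [fourierInv_fourier_eq, Lp.toTemperedDistribution_apply] at H1
      have H2 := VectorFourier.integral_fourierIntegral_smul_eq_flip (L := innerₗ (Space n))
        Real.continuous_fourierChar continuous_inner (ψ.integrable (μ := volume)) hf
      rw [flip_innerₗ] at H2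
      have hi : Integrable fun ξ => ψ ξ * 𝓕 (f : Space n → ℂ) ξ :=
        (ψ.integrable (μ := volume)).mul_bdd (c := ∫ x, ‖f x‖) hcont.aestronglyMeasurable
          (Filter.Eventually.of_forall hbound)
      simp only [Pi.sub_apply, mul_sub]
      rw [integral_sub (integrable_schwartz_mul ψ _) hi, ← H1, sub_eq_zero]
      exact H2)
  filter_upwards [this] with ξ hξ
  exact sub_eq_zero.1 hξ

namespace MemL11

variable {f : L2 n}

theorem integrable (hf : MemL11 f) : Integrable (f : Space n → ℂ) := by
  refine Integrable.mono hf (Lp.aestronglyMeasurable f) (Filter.Eventually.of_forall fun x => ?_)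
  rw [Real.norm_eq_abs, abs_of_nonneg (by positivity)]
  nlinarith [norm_nonneg x, norm_nonneg (f x), mul_nonneg (norm_nonneg x) (norm_nonneg (f x))]

/-- From |exp(iθ) − 1| ≤ |θ|, the weight |x| pays for one factor |ξ|. -/
theorem norm_fourier_sub_mean_le (hf : MemL11 f) (ξ : Space n) :
    ‖𝓕 (f : Space n → ℂ) ξ - mean f‖ ≤ 2 * Real.pi * ‖ξ‖ * normL11 f := by
  have hi : Integrable fun x : Space n => 𝐞 (-(inner ℝ x ξ)) • f x :=
    (Real.fourierIntegral_convergent_iff ξ).2 hf.integrable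
  rw [Real.fourier_eq, mean, ← integral_sub hi hf.integrable, normL11, ← integral_const_mul]
  refine norm_integral_le_of_norm_le (hf.const_mul _) (Filter.Eventually.of_forall fun x => ?_)
  have h1 : 𝐞 (-(inner ℝ x ξ)) • f x - f x =
      (Complex.exp (Complex.I * ((-(2 * Real.pi * inner ℝ x ξ) : ℝ) : ℂ)) - 1) * f x := by
    rw [Circle.smul_def, Real.fourierChar_apply, sub_mul, one_mul, smul_eq_mul]
    congr 3
    push_cast
    ring
  rw [h1, norm_mul]
  have h2 := Real.norm_exp_I_mul_ofReal_sub_one_le (x := -(2 * Real.pi * inner ℝ x ξ))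
  have h3 : ‖-(2 * Real.pi * inner ℝ x ξ)‖ ≤ 2 * Real.pi * (‖x‖ * ‖ξ‖) := by
    rw [norm_neg, norm_mul, Real.norm_of_nonneg Real.two_pi_pos.le]
    gcongr
    exact norm_inner_le_norm x ξ
  calc _ ≤ 2 * Real.pi * (‖x‖ * ‖ξ‖) * ‖f x‖ := by gcongr; exact h2.trans h3
    _ ≤ 2 * Real.pi * ((1 + ‖x‖) * ‖ξ‖) * ‖f x‖ := by gcongr; linarith
    _ = _ := by ring

end MemL11

/-! ### Differentiation in L² by dominated convergence -/

theorem norm_sq_L2 (f : L2 n) : ‖f‖ ^ 2 = ∫ ξ, ‖f ξ‖ ^ 2 := by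
  have h1 : inner ℂ f f = ((∫ ξ, ‖f ξ‖ ^ 2 : ℝ) : ℂ) := by
    rw [L2.inner_def, ← integral_complex_ofReal]
    refine integral_congr_ae (Filter.Eventually.of_forall fun ξ => ?_)
    simp only [inner_self_eq_norm_sq_to_K]
    norm_cast
  have h2 : inner ℂ f f = ((‖f‖ ^ 2 : ℝ) : ℂ) := by
    rw [inner_self_eq_norm_sq_to_K]; norm_cast
  exact_mod_cast h2.symm.trans h1

theorem integrable_norm_sq_L2 (f : L2 n) : Integrable fun ξ => ‖f ξ‖ ^ 2 :=
  (Lp.memLp f).norm.integrable_sq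

/-- Dominated convergence in `L²`. -/
theorem tendsto_L2_of_dominated {ι : Type*} {l : Filter ι} [l.IsCountablyGenerated]
    {U : ι → L2 n} {V : L2 n} {F : ι → Space n → ℂ} {G : Space n → ℂ} {B : Space n → ℝ}
    (hB : MemLp B 2) (hU : ∀ᶠ i in l, U i =ᵐ[volume] F i) (hV : V =ᵐ[volume] G)
    (hb : ∀ᶠ i in l, ∀ᵐ ξ, ‖F i ξ - G ξ‖ ≤ B ξ)
    (ht : ∀ᵐ ξ, Filter.Tendsto (fun i => F i ξ) l (nhds (G ξ))) :
    Filter.Tendsto U l (nhds V) := by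
  have h1 : Filter.Tendsto (fun i => ∫ ξ, ‖(U i - V : L2 n) ξ‖ ^ 2) l
      (nhds (∫ _ : Space n, (0 : ℝ))) := by
    have h2 : Filter.Tendsto (fun i => ∫ ξ, ‖F i ξ - G ξ‖ ^ 2) l
        (nhds (∫ _ : Space n, (0 : ℝ))) := by
      refine tendsto_integral_filter_of_dominated_convergence (fun ξ => B ξ ^ 2) ?_ ?_
        hB.integrable_sq ?_
      · filter_upwards [hU] with i hi
        have hF := (Lp.aestronglyMeasurable (U i)).congr hi
        have hG := (Lp.aestronglyMeasurable V).congr hV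
        exact (hF.sub hG).norm.pow 2
      · filter_upwards [hb] with i hi
        filter_upwards [hi] with ξ hξ
        rw [norm_pow, norm_norm]
        gcongr
      · filter_upwards [ht] with ξ hξ
        have := (((hξ.sub_const (G ξ)).norm).pow 2)
        simpa using this
    refine h2.congr' ?_
    filter_upwards [hU] with i hi
    refine integral_congr_ae ?_
    filter_upwards [hi, hV, Lp.coeFn_sub (U i) V] with ξ h1 h2 h3
    rw [h3, Pi.sub_apply, h1, h2]
  simp only [← norm_sq_L2, integral_zero] at h1
  rw [tendsto_iff_norm_sub_tendsto_zero]
  have h3 := h1.sqrt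
  simpa [Real.sqrt_sq (norm_nonneg _)] using h3

theorem continuousOn_L2_of_dominated {U : ℝ → L2 n} {F : ℝ → Space n → ℂ} {B : Space n → ℝ}
    (hB : MemLp B 2) (hU : ∀ t, 0 ≤ t → U t =ᵐ[volume] F t)
    (hF : ∀ ξ, Continuous fun t => F t ξ) (hb : ∀ t, 0 ≤ t → ∀ ξ, ‖F t ξ‖ ≤ B ξ) :
    ContinuousOn U (Ici 0) := fun t ht =>
  tendsto_L2_of_dominated (hB.const_mul 2)
    (by filter_upwards [self_mem_nhdsWithin] with y hy using hU y hy) (hU t ht)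
    (by
      filter_upwards [self_mem_nhdsWithin] with y hy
      refine Filter.Eventually.of_forall fun ξ => ?_
      have := norm_sub_le (F y ξ) (F t ξ)
      have h1 := hb y hy ξ
      have h2 := hb t ht ξ
      linarith)
    (Filter.Eventually.of_forall fun ξ => (hF ξ).continuousAt.continuousWithinAt)

/-- By the mean value inequality `B` dominates the difference quotients as well as `F'`, hence 2B
dominates their difference. -/
theorem hasDerivWithinAt_L2_of_dominated {U V : ℝ → L2 n} {F F' : ℝ → Space n → ℂ}
    {B : Space n → ℝ} (hB : MemLp B 2) (hU : ∀ t, 0 ≤ t → U t =ᵐ[volume] F t)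
    (hV : ∀ t, 0 ≤ t → V t =ᵐ[volume] F' t)
    (hF : ∀ ξ t, HasDerivAt (fun t => F t ξ) (F' t ξ) t)
    (hb : ∀ t, 0 ≤ t → ∀ ξ, ‖F' t ξ‖ ≤ B ξ) {t : ℝ} (ht : 0 ≤ t) :
    HasDerivWithinAt U (V t) (Ici 0) t := by
  rw [hasDerivWithinAt_iff_tendsto_slope]
  refine tendsto_L2_of_dominated (F := fun y ξ => slope (fun τ => F τ ξ) t y)
    (hB.const_mul 2) ?_ (hV t ht) ?_ ?_
  · filter_upwards [self_mem_nhdsWithin] with y hy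
    have h1 : slope U t y = ((y - t)⁻¹ : ℝ) • (U y - U t) := by rw [slope_def_module]
    rw [h1]
    filter_upwards [Lp.coeFn_smul ((y - t)⁻¹ : ℝ) (U y - U t), Lp.coeFn_sub (U y) (U t),
      hU y hy.1, hU t ht] with ξ e1 e2 e3 e4
    rw [e1, Pi.smul_apply, e2, Pi.sub_apply, e3, e4, slope_def_module]
  · filter_upwards [self_mem_nhdsWithin] with y hy
    refine Filter.Eventually.of_forall fun ξ => ?_
    have h1 : ‖F y ξ - F t ξ‖ ≤ B ξ * ‖y - t‖ :=
      (convex_Ici 0).norm_image_sub_le_of_norm_hasDerivWithin_le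
        (fun x _ => (hF ξ x).hasDerivWithinAt) (fun x hx => hb x hx ξ) ht hy.1
    have hyt : 0 < ‖y - t‖ := norm_pos_iff.2 (sub_ne_zero.2 hy.2)
    have h2 : ‖slope (fun τ => F τ ξ) t y‖ ≤ B ξ := by
      rw [slope_def_module, norm_smul, norm_inv, inv_mul_le_iff₀ hyt, mul_comm]
      exact h1
    have := norm_sub_le (slope (fun τ => F τ ξ) t y) (F' t ξ)
    have h3 := hb t ht ξ
    linarith
  · refine Filter.Eventually.of_forall fun ξ => ?_
    exact hasDerivWithinAt_iff_tendsto_slope.1 (hF ξ t).hasDerivWithinAt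

/-- Duhamel's formula for a relaxation equation `m' = u - γ m` with `m(0) = 0`, after applying a
continuous functional. -/
theorem integral_exp_mul_eq {γ : ℝ} {m u : ℝ → L2 n} (T : L2 n →L[ℂ] ℂ)
    (hm : ∀ t, 0 ≤ t → HasDerivWithinAt m (u t - (γ : ℂ) • m t) (Ici 0) t)
    (hm0 : m 0 = 0) (hu : ContinuousOn u (Ici 0)) {t : ℝ} (ht : 0 ≤ t) :
    ∫ η in (0 : ℝ)..t, (Real.exp (-γ * (t - η)) : ℂ) * T (u η) = T (m t) := by
  have hd : ∀ x, 0 ≤ x → HasDerivWithinAt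
      (fun η => (Real.exp (-γ * (t - η)) : ℂ) * T (m η))
      ((Real.exp (-γ * (t - x)) : ℂ) * T (u x)) (Ici 0) x := fun x hx => by
    have h1 : HasDerivAt (fun η => Real.exp (-γ * (t - η)))
        (Real.exp (-γ * (t - x)) * (-γ * -1)) x :=
      (((hasDerivAt_id x).const_sub t).const_mul (-γ)).exp
    have h2 := ((T.restrictScalars ℝ).hasFDerivAt.comp_hasDerivWithinAt x (hm x hx))
    have h3 := (h1.ofReal_comp.hasDerivWithinAt (s := Ici 0)).mul h2
    refine h3.congr_deriv ?_
    simp only [Function.comp_apply, ContinuousLinearMap.coe_restrictScalars', map_sub, map_smul,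
      smul_eq_mul]
    push_cast
    ring
  have hcont : ContinuousOn (fun η => (Real.exp (-γ * (t - η)) : ℂ) * T (u η)) (Icc 0 t) := by
    refine ContinuousOn.mul ?_ (T.continuous.comp_continuousOn (hu.mono Icc_subset_Ici_self))
    exact Continuous.continuousOn (by fun_prop)
  rw [intervalIntegral.integral_eq_sub_of_hasDeriv_right_of_le ht
    (f := fun η => (Real.exp (-γ * (t - η)) : ℂ) * T (m η))
    (fun x hx => ((hd x hx.1).continuousWithinAt).mono Icc_subset_Ici_self)
    (fun x hx => (hd x hx.1.le).mono (fun y hy => hx.1.le.trans (le_of_lt hy)))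
    (hcont.intervalIntegrable_of_Icc ht)]
  simp [hm0]

/-! ### Superposition of the fundamental modes -/

/-- Initial state of the mode with unit amplitude, zero velocity and empty memory. -/
noncomputable def modeA (γ : ℝ) : ℝ × ℝ × ℝ := (1, 0, γ⁻¹)

/-- Initial state of the mode with zero amplitude, unit velocity and empty memory. -/
def modeB : ℝ × ℝ × ℝ := (0, 1, 0)

section bounds

variable {γ r t : ℝ}

/-- Empty memory means z(0) = 1/γ, and (1 − 1/γ) + γ·γ⁻² = 1. -/
theorem modeA_energy (hγ : 1 < γ) : (modeFlow γ r 0 (modeA γ)).2.1 ^ 2 +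
    ((1 - γ⁻¹) * (modeFlow γ r 0 (modeA γ)).1 ^ 2 + γ * (modeFlow γ r 0 (modeA γ)).2.2 ^ 2) ≤ 1 := by
  have : γ ≠ 0 := by linarith
  rw [modeFlow_zero, modeA]
  apply le_of_eq
  field_simp
  ring

theorem modeB_energy : (modeFlow γ r 0 modeB).2.1 ^ 2 +
    ((1 - γ⁻¹) * (modeFlow γ r 0 modeB).1 ^ 2 + γ * (modeFlow γ r 0 modeB).2.2 ^ 2) ≤ 1 := by
  rw [modeFlow_zero, modeB]
  norm_num

theorem abs_modeA_amplitude_le (hγ : 1 < γ) (hr : 0 ≤ r) (ht : 0 ≤ t) :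
    |(modeFlow γ r t (modeA γ)).1| ≤ 1 + 5 * t := by
  have := (isMode_modeFlow γ r (modeA γ)).abs_amplitude_le hγ hr (modeA_energy hγ) ht
  simpa [modeFlow_zero, modeA] using this

theorem abs_modeB_amplitude_le (hγ : 1 < γ) (hr : 0 ≤ r) (ht : 0 ≤ t) :
    |(modeFlow γ r t modeB).1| ≤ 1 + 5 * t := by
  have := (isMode_modeFlow γ r modeB).abs_amplitude_le hγ hr modeB_energy ht
  rw [modeFlow_zero, modeB] at this
  simp only [abs_zero, zero_add] at this
  exact this.trans (by linarith)

end bounds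

/-- The superposition `a(t, |ξ|²) f(ξ) + b(t, |ξ|²) g(ξ)` of the fundamental modes, where `P`
selects the component of the state. -/
noncomputable def modeSum (γ : ℝ) (P : ℝ × ℝ × ℝ → ℝ) (f g : Space n → ℂ) (t : ℝ) (ξ : Space n) :
    ℂ :=
  ((P (modeFlow γ (freqSq ξ) t (modeA γ)) : ℝ) : ℂ) * f ξ
    + ((P (modeFlow γ (freqSq ξ) t modeB) : ℝ) : ℂ) * g ξ

theorem norm_modeSum_le {γ : ℝ} {P : ℝ × ℝ × ℝ → ℝ} {f g : Space n → ℂ} {t K : ℝ} {ξ : Space n}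
    (hA : |P (modeFlow γ (freqSq ξ) t (modeA γ))| ≤ K)
    (hB : |P (modeFlow γ (freqSq ξ) t modeB)| ≤ K) :
    ‖modeSum γ P f g t ξ‖ ≤ K * (‖f ξ‖ + ‖g ξ‖) := by
  unfold modeSum
  refine (norm_add_le _ _).trans ?_
  rw [norm_mul, norm_mul, Complex.norm_real, Complex.norm_real, mul_add]
  simp only [Real.norm_eq_abs]
  gcongr

theorem memLp_norm_add_norm (f g : L2 n) : MemLp (fun ξ => ‖f ξ‖ + ‖g ξ‖) 2 volume :=
  (Lp.memLp f).norm.add (Lp.memLp g).norm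

section modeSum

variable {γ : ℝ} {t : ℝ} {ξ : Space n}

theorem norm_modeSum_amplitude_le (hγ : 1 < γ) (f g : Space n → ℂ) (ht : 0 ≤ t) (ξ : Space n) :
    ‖modeSum γ Prod.fst f g t ξ‖ ≤ (1 + 5 * t) * (‖f ξ‖ + ‖g ξ‖) :=
  norm_modeSum_le (abs_modeA_amplitude_le hγ (freqSq_nonneg ξ) ht)
    (abs_modeB_amplitude_le hγ (freqSq_nonneg ξ) ht)

theorem norm_modeSum_velocity_le (hγ : 1 < γ) (f g : Space n → ℂ) (ht : 0 ≤ t) (ξ : Space n) :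
    ‖modeSum γ (fun x => x.2.1) f g t ξ‖ ≤ 5 * (‖f ξ‖ + ‖g ξ‖) :=
  norm_modeSum_le
    ((isMode_modeFlow γ _ (modeA γ)).abs_velocity_le hγ (freqSq_nonneg ξ) (modeA_energy hγ) ht)
    ((isMode_modeFlow γ _ modeB).abs_velocity_le hγ (freqSq_nonneg ξ) modeB_energy ht)

theorem norm_modeSum_history_le (hγ : 1 < γ) (f g : Space n → ℂ) (ht : 0 ≤ t) (ξ : Space n) :
    ‖modeSum γ (fun x => x.2.2) f g t ξ‖ ≤ 5 * (‖f ξ‖ + ‖g ξ‖) :=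
  norm_modeSum_le
    ((isMode_modeFlow γ _ (modeA γ)).abs_history_le hγ (freqSq_nonneg ξ) (modeA_energy hγ) ht)
    ((isMode_modeFlow γ _ modeB).abs_history_le hγ (freqSq_nonneg ξ) modeB_energy ht)

theorem hasDerivAt_modeSum_amplitude (f g : Space n → ℂ) (ξ : Space n) (t : ℝ) :
    HasDerivAt (fun t => modeSum γ Prod.fst f g t ξ) (modeSum γ (fun x => x.2.1) f g t ξ) t :=
  ((((isMode_modeFlow γ (freqSq ξ) (modeA γ)).hw t).ofReal_comp).mul_const (f ξ)).add
    ((((isMode_modeFlow γ (freqSq ξ) modeB).hw t).ofReal_comp).mul_const (g ξ))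

theorem hasDerivAt_modeSum_velocity (f g : Space n → ℂ) (ξ : Space n) (t : ℝ) :
    HasDerivAt (fun t => modeSum γ (fun x => x.2.1) f g t ξ)
      (-((freqSq ξ : ℝ) : ℂ) * ((1 - (γ : ℂ)⁻¹) * modeSum γ Prod.fst f g t ξ
        + modeSum γ (fun x => x.2.1) f g t ξ + modeSum γ (fun x => x.2.2) f g t ξ)) t :=
  (((((isMode_modeFlow γ (freqSq ξ) (modeA γ)).hv t).ofReal_comp).mul_const (f ξ)).add
    ((((isMode_modeFlow γ (freqSq ξ) modeB).hv t).ofReal_comp).mul_const (g ξ))).congr_deriv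
    (by simp only [modeSum]; push_cast; ring)

theorem hasDerivAt_modeSum_history (f g : Space n → ℂ) (ξ : Space n) (t : ℝ) :
    HasDerivAt (fun t => modeSum γ (fun x => x.2.2) f g t ξ)
      ((γ : ℂ)⁻¹ * modeSum γ (fun x => x.2.1) f g t ξ
        - γ * modeSum γ (fun x => x.2.2) f g t ξ) t :=
  (((((isMode_modeFlow γ (freqSq ξ) (modeA γ)).hz t).ofReal_comp).mul_const (f ξ)).add
    ((((isMode_modeFlow γ (freqSq ξ) modeB).hz t).ofReal_comp).mul_const (g ξ))).congr_deriv
    (by simp only [modeSum]; push_cast; ring)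

end modeSum

theorem aestronglyMeasurable_modeSum (γ : ℝ) {P : ℝ × ℝ × ℝ → ℝ} (hP : Continuous P) (f g : L2 n)
    (t : ℝ) : AEStronglyMeasurable (modeSum γ P f g t) volume := by
  have h : ∀ x, Continuous fun ξ : Space n => ((P (modeFlow γ (freqSq ξ) t x) : ℝ) : ℂ) := fun x =>
    Complex.continuous_ofReal.comp
      (hP.comp ((continuous_modeFlow γ t x).comp continuous_freqSq))
  exact ((h _).aestronglyMeasurable.mul (Lp.aestronglyMeasurable f)).add
    ((h _).aestronglyMeasurable.mul (Lp.aestronglyMeasurable g))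

theorem memLp_modeSum {γ : ℝ} {P : ℝ × ℝ × ℝ → ℝ} (hP : Continuous P) (f g : L2 n) {t K : ℝ}
    (h : ∀ ξ, ‖modeSum γ P f g t ξ‖ ≤ K * (‖f ξ‖ + ‖g ξ‖)) : MemLp (modeSum γ P f g t) 2 volume :=
  (memLp_norm_add_norm f g).of_le_mul (c := K) (aestronglyMeasurable_modeSum γ hP f g t)
    (Filter.Eventually.of_forall fun ξ => by
      rw [Real.norm_of_nonneg (by positivity)]; exact h ξ)

open Classical in
/-- The class in `L²` of a superposition of modes (zero when it is not square integrable). -/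
noncomputable def modeSumL2 (γ : ℝ) (P : ℝ × ℝ × ℝ → ℝ) (f g : L2 n) (t : ℝ) : L2 n :=
  if h : MemLp (modeSum γ P f g t) 2 volume then h.toLp _ else 0

theorem modeSumL2_coeFn {γ : ℝ} {P : ℝ × ℝ × ℝ → ℝ} {f g : L2 n} {t : ℝ}
    (h : MemLp (modeSum γ P f g t) 2 volume) :
    modeSumL2 γ P f g t =ᵐ[volume] modeSum γ P f g t := by
  rw [modeSumL2, dif_pos h]
  exact h.coeFn_toLp

section L2

variable {γ : ℝ} {t : ℝ}

theorem amplitudeL2_coeFn (hγ : 1 < γ) (f g : L2 n) (ht : 0 ≤ t) :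
    modeSumL2 γ Prod.fst f g t =ᵐ[volume] modeSum γ Prod.fst f g t :=
  modeSumL2_coeFn (memLp_modeSum (by fun_prop) f g (norm_modeSum_amplitude_le hγ f g ht))

theorem velocityL2_coeFn (hγ : 1 < γ) (f g : L2 n) (ht : 0 ≤ t) :
    modeSumL2 γ (fun x => x.2.1) f g t =ᵐ[volume] modeSum γ (fun x => x.2.1) f g t :=
  modeSumL2_coeFn (memLp_modeSum (by fun_prop) f g (norm_modeSum_velocity_le hγ f g ht))

theorem historyL2_coeFn (hγ : 1 < γ) (f g : L2 n) (ht : 0 ≤ t) :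
    modeSumL2 γ (fun x => x.2.2) f g t =ᵐ[volume] modeSum γ (fun x => x.2.2) f g t :=
  modeSumL2_coeFn (memLp_modeSum (by fun_prop) f g (norm_modeSum_history_le hγ f g ht))

theorem hasDerivWithinAt_amplitudeL2 (hγ : 1 < γ) (f g : L2 n) (ht : 0 ≤ t) :
    HasDerivWithinAt (modeSumL2 γ Prod.fst f g) (modeSumL2 γ (fun x => x.2.1) f g t) (Ici 0) t :=
  hasDerivWithinAt_L2_of_dominated ((memLp_norm_add_norm f g).const_mul 5)
    (fun _ ht => amplitudeL2_coeFn hγ f g ht) (fun _ ht => velocityL2_coeFn hγ f g ht)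
    (fun ξ t => hasDerivAt_modeSum_amplitude f g ξ t)
    (fun _ ht ξ => norm_modeSum_velocity_le hγ f g ht ξ) ht

theorem continuousOn_velocityL2 (hγ : 1 < γ) (f g : L2 n) :
    ContinuousOn (modeSumL2 γ (fun x => x.2.1) f g) (Ici 0) :=
  continuousOn_L2_of_dominated ((memLp_norm_add_norm f g).const_mul 5)
    (fun _ ht => velocityL2_coeFn hγ f g ht)
    (fun ξ => continuous_iff_continuousAt.2 fun t =>
      (hasDerivAt_modeSum_velocity f g ξ t).continuousAt)
    (fun _ ht ξ => norm_modeSum_velocity_le hγ f g ht ξ)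

/-- The memory integral of the superposition. -/
noncomputable def memoryL2 (γ : ℝ) (f g : L2 n) (t : ℝ) : L2 n :=
  (γ : ℂ)⁻¹ • modeSumL2 γ Prod.fst f g t - modeSumL2 γ (fun x => x.2.2) f g t

theorem memoryL2_coeFn (hγ : 1 < γ) (f g : L2 n) (ht : 0 ≤ t) :
    memoryL2 γ f g t =ᵐ[volume] fun ξ => (γ : ℂ)⁻¹ * modeSum γ Prod.fst f g t ξ
      - modeSum γ (fun x => x.2.2) f g t ξ := by
  filter_upwards [amplitudeL2_coeFn hγ f g ht, historyL2_coeFn hγ f g ht,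
    Lp.coeFn_sub ((γ : ℂ)⁻¹ • modeSumL2 γ Prod.fst f g t) (modeSumL2 γ (fun x => x.2.2) f g t),
    Lp.coeFn_smul ((γ : ℂ)⁻¹) (modeSumL2 γ Prod.fst f g t)] with ξ h1 h2 h3 h4
  rw [memoryL2, h3, Pi.sub_apply, h4, Pi.smul_apply, h1, h2, smul_eq_mul]

theorem memoryL2_zero (hγ : 1 < γ) (f g : L2 n) : memoryL2 γ f g 0 = 0 := by
  refine Lp.ext ?_
  filter_upwards [memoryL2_coeFn hγ f g le_rfl, Lp.coeFn_zero ℂ 2 (volume : Measure (Space n))]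
    with ξ h1 h2
  rw [h1, h2]
  simp [modeSum, modeFlow_zero, modeA, modeB]

theorem hasDerivWithinAt_memoryL2 (hγ : 1 < γ) (f g : L2 n) (ht : 0 ≤ t) :
    HasDerivWithinAt (memoryL2 γ f g)
      (modeSumL2 γ Prod.fst f g t - (γ : ℂ) • memoryL2 γ f g t) (Ici 0) t := by
  have hγ0 : (γ : ℂ) ≠ 0 := by
    have : γ ≠ 0 := by linarith
    exact_mod_cast this
  have h0 : 0 ≤ γ := by linarith
  refine hasDerivWithinAt_L2_of_dominated
    (V := fun t => modeSumL2 γ Prod.fst f g t - (γ : ℂ) • memoryL2 γ f g t)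
    -- The velocity terms cancel and leave γz, which is bounded uniformly in time, unlike the
    -- available bound on the amplitude.
    (F' := fun t ξ => (γ : ℂ)⁻¹ * modeSum γ (fun x => x.2.1) f g t ξ
      - ((γ : ℂ)⁻¹ * modeSum γ (fun x => x.2.1) f g t ξ
        - γ * modeSum γ (fun x => x.2.2) f g t ξ))
    ((memLp_norm_add_norm f g).const_mul (γ * 5))
    (fun _ ht => memoryL2_coeFn hγ f g ht) (fun t ht => ?_)
    (fun ξ t => ((hasDerivAt_modeSum_amplitude f g ξ t).const_mul _).sub
      (hasDerivAt_modeSum_history f g ξ t)) (fun t ht ξ => ?_) ht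
  · filter_upwards [amplitudeL2_coeFn hγ f g ht, memoryL2_coeFn hγ f g ht,
      Lp.coeFn_sub (modeSumL2 γ Prod.fst f g t) ((γ : ℂ) • memoryL2 γ f g t),
      Lp.coeFn_smul (γ : ℂ) (memoryL2 γ f g t)] with ξ h1 h2 h3 h4
    rw [h3, Pi.sub_apply, h4, Pi.smul_apply, h1, h2, smul_eq_mul]
    field_simp
    ring
  · rw [sub_sub_cancel, norm_mul, Complex.norm_real, Real.norm_of_nonneg h0, mul_assoc]
    gcongr
    exact norm_modeSum_history_le hγ f g ht ξ

end L2

/-! ### Existence -/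

/-- The solution of the Cauchy problem. -/
noncomputable def solution (γ : ℝ) (u₀ u₁ : L2 n) (t : ℝ) : L2 n :=
  𝓕⁻ (modeSumL2 γ Prod.fst (𝓕 u₀) (𝓕 u₁) t)

section solution

variable {γ : ℝ}

theorem fourierInv_sub_L2 (f g : L2 n) : (𝓕⁻ (f - g) : L2 n) = 𝓕⁻ f - 𝓕⁻ g :=
  map_sub (fourierInvCLM ℂ (L2 n) (F := L2 n)) f g

theorem hasDerivWithinAt_fourierInv {U : ℝ → L2 n} {U' : L2 n} {s : Set ℝ} {t : ℝ}
    (h : HasDerivWithinAt U U' s t) :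
    HasDerivWithinAt (fun t => (𝓕⁻ (U t) : L2 n)) (𝓕⁻ U') s t :=
  ((fourierInvCLM ℂ (L2 n) (F := L2 n)).restrictScalars ℝ).hasFDerivAt.comp_hasDerivWithinAt t h

theorem hasDerivWithinAt_solution (hγ : 1 < γ) (u₀ u₁ : L2 n) {t : ℝ} (ht : 0 ≤ t) :
    HasDerivWithinAt (solution γ u₀ u₁)
      (𝓕⁻ (modeSumL2 γ (fun x => x.2.1) (𝓕 u₀) (𝓕 u₁) t)) (Ici 0) t :=
  hasDerivWithinAt_fourierInv (hasDerivWithinAt_amplitudeL2 hγ _ _ ht)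

theorem timeDeriv_solution (hγ : 1 < γ) (u₀ u₁ : L2 n) {t : ℝ} (ht : 0 ≤ t) :
    timeDeriv (solution γ u₀ u₁) t = 𝓕⁻ (modeSumL2 γ (fun x => x.2.1) (𝓕 u₀) (𝓕 u₁) t) :=
  (hasDerivWithinAt_solution hγ u₀ u₁ ht).derivWithin (uniqueDiffOn_Ici 0 t ht)

/-- The velocity is differentiated only after pairing, because its derivative carries the unbounded
factor |ξ|², which ψ absorbs. -/
theorem hasDerivAt_velocity_pairing (hγ : 1 < γ) (f g : L2 n) (ψ : 𝓢(Space n, ℂ)) {t : ℝ}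
    (ht : 0 < t) :
    HasDerivAt (fun τ => ∫ ξ, ψ ξ * modeSum γ (fun x => x.2.1) f g τ ξ)
      (∫ ξ, ψ ξ * (-((freqSq ξ : ℝ) : ℂ) * ((1 - (γ : ℂ)⁻¹) * modeSum γ Prod.fst f g t ξ
        + modeSum γ (fun x => x.2.1) f g t ξ + modeSum γ (fun x => x.2.2) f g t ξ))) t := by
  have hk0 : 0 ≤ 1 - γ⁻¹ := by have := inv_lt_one_of_one_lt₀ hγ; linarith
  have hk1 : 1 - γ⁻¹ ≤ 1 := by have : 0 ≤ γ⁻¹ := inv_nonneg.2 (by linarith)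
                               linarith
  have hk : ‖1 - (γ : ℂ)⁻¹‖ ≤ 1 := by
    have : (1 - (γ : ℂ)⁻¹) = ((1 - γ⁻¹ : ℝ) : ℂ) := by push_cast; rfl
    rw [this, Complex.norm_real, Real.norm_of_nonneg hk0]
    exact hk1
  have hψm : AEStronglyMeasurable (fun ξ => ψ ξ) volume := ψ.continuous.aestronglyMeasurable
  have hmeas := fun {P : ℝ × ℝ × ℝ → ℝ} (hP : Continuous P) (τ : ℝ) =>
    aestronglyMeasurable_modeSum γ hP f g τ
  have hr : AEStronglyMeasurable (fun ξ : Space n => -((freqSq ξ : ℝ) : ℂ)) volume :=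
    (Complex.continuous_ofReal.comp continuous_freqSq).neg.aestronglyMeasurable
  refine (hasDerivAt_integral_of_dominated_loc_of_deriv_le (s := Ioo 0 (t + 1))
    -- The amplitude contributes 1 + 5(t + 1) on this time interval, velocity and history 5 each.
    (bound := fun ξ => (11 + 5 * (t + 1)) *
      (‖(SchwartzMap.smulLeftCLM ℂ (fun ξ : Space n => ((freqSq ξ : ℝ) : ℂ)) ψ) ξ‖ *
      (‖f ξ‖ + ‖g ξ‖)))
    (F' := fun τ ξ => ψ ξ * (-((freqSq ξ : ℝ) : ℂ) * ((1 - (γ : ℂ)⁻¹) * modeSum γ Prod.fst f g τ ξ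
        + modeSum γ (fun x => x.2.1) f g τ ξ + modeSum γ (fun x => x.2.2) f g τ ξ)))
    (Ioo_mem_nhds ht (by linarith)) ?_ ?_ ?_ ?_ ?_ ?_).2
  · exact Filter.Eventually.of_forall fun τ => hψm.mul (hmeas (by fun_prop) τ)
  · exact (ψ.memLp 2).integrable_mul
      (memLp_modeSum (by fun_prop) f g (norm_modeSum_velocity_le hγ f g ht.le))
  · exact hψm.mul (hr.mul ((((hmeas (by fun_prop) t).const_mul _).add
      (hmeas (by fun_prop) t)).add (hmeas (by fun_prop) t)))
  · refine Filter.Eventually.of_forall fun ξ τ hτ => ?_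
    have h1 := norm_modeSum_amplitude_le hγ f g hτ.1.le ξ
    have h2 := norm_modeSum_velocity_le hγ f g hτ.1.le ξ
    have h3 := norm_modeSum_history_le hγ f g hτ.1.le ξ
    have h0 : 0 ≤ ‖f ξ‖ + ‖g ξ‖ := by positivity
    have h4 : (1 + 5 * τ) * (‖f ξ‖ + ‖g ξ‖) ≤ (1 + 5 * (t + 1)) * (‖f ξ‖ + ‖g ξ‖) := by
      gcongr; exact hτ.2.le
    rw [SchwartzMap.smulLeftCLM_apply_apply hasTemperateGrowth_freqSq, smul_eq_mul, norm_mul,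
      norm_mul, norm_mul, norm_neg]
    have h5 : ‖(1 - (γ : ℂ)⁻¹) * modeSum γ Prod.fst f g τ ξ
        + modeSum γ (fun x => x.2.1) f g τ ξ + modeSum γ (fun x => x.2.2) f g τ ξ‖ ≤
        (11 + 5 * (t + 1)) * (‖f ξ‖ + ‖g ξ‖) := by
      refine (norm_add₃_le).trans ?_
      rw [norm_mul]
      have h6 : ‖1 - (γ : ℂ)⁻¹‖ * ‖modeSum γ Prod.fst f g τ ξ‖ ≤
        1 * ‖modeSum γ Prod.fst f g τ ξ‖ := by gcongr
      linarith
    calc _ ≤ ‖ψ ξ‖ * (‖((freqSq ξ : ℝ) : ℂ)‖ * ((11 + 5 * (t + 1)) * (‖f ξ‖ + ‖g ξ‖))) := by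
          gcongr
      _ = _ := by ring
  · exact ((((SchwartzMap.smulLeftCLM ℂ (fun ξ : Space n => ((freqSq ξ : ℝ) : ℂ)) ψ).memLp 2
      volume).norm.integrable_mul (memLp_norm_add_norm f g))).const_mul _
  · exact Filter.Eventually.of_forall fun ξ τ _ =>
      (hasDerivAt_modeSum_velocity f g ξ τ).const_mul (ψ ξ)

theorem isSolution_solution (hγ : 1 < γ) (u₀ u₁ : L2 n) :
    IsSolution γ u₀ u₁ (solution γ u₀ u₁) where
  contDiffOn := by
    rw [contDiffOn_one_iff_derivWithin (uniqueDiffOn_Ici 0)]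
    refine ⟨fun t ht => (hasDerivWithinAt_solution hγ u₀ u₁ ht).differentiableWithinAt, ?_⟩
    have h := (fourierInvCLM ℂ (L2 n) (F := L2 n)).continuous.comp_continuousOn
      (continuousOn_velocityL2 hγ (𝓕 u₀) (𝓕 u₁))
    exact h.congr fun t ht => timeDeriv_solution hγ u₀ u₁ ht
  initial_value := by
    have : modeSumL2 γ Prod.fst (𝓕 u₀) (𝓕 u₁) 0 = 𝓕 u₀ := by
      refine Lp.ext ?_
      filter_upwards [amplitudeL2_coeFn hγ (𝓕 u₀) (𝓕 u₁) le_rfl] with ξ h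
      rw [h]
      simp [modeSum, modeFlow_zero, modeA, modeB]
    rw [solution, this, fourierInv_fourier_eq]
  initial_velocity := by
    have : modeSumL2 γ (fun x => x.2.1) (𝓕 u₀) (𝓕 u₁) 0 = 𝓕 u₁ := by
      refine Lp.ext ?_
      filter_upwards [velocityL2_coeFn hγ (𝓕 u₀) (𝓕 u₁) le_rfl] with ξ h
      rw [h]
      simp [modeSum, modeFlow_zero, modeA, modeB]
    rw [timeDeriv_solution hγ u₀ u₁ le_rfl, this, fourierInv_fourier_eq]
  equation φ t ht := by
    -- Duhamel's formula identifies the paired memory integral with the pairing of w/γ − z.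
    have hm := integral_exp_mul_eq ((pairCLM (Δ φ)).comp (fourierInvCLM ℂ (L2 n)))
      (fun t ht => hasDerivWithinAt_memoryL2 hγ (𝓕 u₀) (𝓕 u₁) ht)
      (memoryL2_zero hγ (𝓕 u₀) (𝓕 u₁))
      (fun t ht => (hasDerivWithinAt_amplitudeL2 hγ (𝓕 u₀) (𝓕 u₁) ht).continuousWithinAt) ht.le
    have hm' : ∫ η in (0 : ℝ)..t, (Real.exp (-γ * (t - η)) : ℂ) *
        (Δ (solution γ u₀ u₁ η : 𝓢'(Space n, ℂ))) φ =
        (Δ ((𝓕⁻ (memoryL2 γ (𝓕 u₀) (𝓕 u₁) t) : L2 n) : 𝓢'(Space n, ℂ))) φ := by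
      simp only [laplacian_pairing]
      exact hm
    rw [hm', timeDeriv_solution hγ u₀ u₁ ht.le, solution]
    simp only [laplacian_pairing]
    rw [← map_add, ← map_sub, ← FourierTransform.fourierInv_add, ← fourierInv_sub_L2,
      ← laplacian_pairing, laplacian_pairing_fourier, fourier_fourierInv_eq]
    refine ((hasDerivAt_velocity_pairing hγ (𝓕 u₀) (𝓕 u₁) (𝓕⁻ φ) ht).congr_of_eventuallyEq
      ?_).congr_deriv ?_
    · filter_upwards [Ioi_mem_nhds ht] with τ hτ
      rw [timeDeriv_solution hγ u₀ u₁ (le_of_lt hτ), pairing_fourier, fourier_fourierInv_eq]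
      refine integral_congr_ae ?_
      filter_upwards [velocityL2_coeFn hγ (𝓕 u₀) (𝓕 u₁) (le_of_lt hτ)] with ξ h
      rw [h]
    · refine integral_congr_ae ?_
      filter_upwards [amplitudeL2_coeFn hγ (𝓕 u₀) (𝓕 u₁) ht.le,
        velocityL2_coeFn hγ (𝓕 u₀) (𝓕 u₁) ht.le, memoryL2_coeFn hγ (𝓕 u₀) (𝓕 u₁) ht.le,
        Lp.coeFn_add (modeSumL2 γ Prod.fst (𝓕 u₀) (𝓕 u₁) t)
          (modeSumL2 γ (fun x => x.2.1) (𝓕 u₀) (𝓕 u₁) t),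
        Lp.coeFn_sub (modeSumL2 γ Prod.fst (𝓕 u₀) (𝓕 u₁) t
          + modeSumL2 γ (fun x => x.2.1) (𝓕 u₀) (𝓕 u₁) t) (memoryL2 γ (𝓕 u₀) (𝓕 u₁) t)]
        with ξ h1 h2 h3 h4 h5
      rw [h5, Pi.sub_apply, h4, Pi.add_apply, h1, h2, h3]
      ring

end solution

/-! ### Uniqueness -/

namespace IsSolution

variable {γ : ℝ} {u₀ u₁ : L2 n} {u : ℝ → L2 n}

theorem continuousOn (h : IsSolution γ u₀ u₁ u) : ContinuousOn u (Ici 0) :=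
  h.contDiffOn.continuousOn

theorem continuousOn_timeDeriv (h : IsSolution γ u₀ u₁ u) : ContinuousOn (timeDeriv u) (Ici 0) :=
  h.contDiffOn.continuousOn_derivWithin (uniqueDiffOn_Ici 0) le_rfl

theorem hasDerivWithinAt (h : IsSolution γ u₀ u₁ u) {t : ℝ} (ht : 0 ≤ t) :
    HasDerivWithinAt u (timeDeriv u t) (Ici 0) t :=
  (h.contDiffOn.differentiableOn one_ne_zero t ht).hasDerivWithinAt

end IsSolution

/-- The memory integral of a continuous function with values in `L²`. -/
noncomputable def memoryIntegral (γ : ℝ) (D : ℝ → L2 n) (t : ℝ) : L2 n :=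
  Real.exp (-γ * t) • ∫ η in (0 : ℝ)..t, Real.exp (γ * η) • D η

theorem hasDerivAt_memoryIntegral {γ : ℝ} {D : ℝ → L2 n} (hD : Continuous D) (t : ℝ) :
    HasDerivAt (memoryIntegral γ D) (D t - (γ : ℂ) • memoryIntegral γ D t) t := by
  have hc : Continuous fun η => Real.exp (γ * η) • D η := by fun_prop
  have h1 : HasDerivAt (fun t => Real.exp (-γ * t)) (Real.exp (-γ * t) * (-γ * 1)) t :=
    ((hasDerivAt_id t).const_mul (-γ)).exp
  refine (h1.smul (hc.integral_hasStrictDerivAt 0 t).hasDerivAt).congr_deriv ?_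
  have h2 : (γ : ℂ) • memoryIntegral γ D t = γ • memoryIntegral γ D t :=
    algebraMap_smul ℂ γ _
  rw [h2, memoryIntegral, smul_smul, smul_smul, ← Real.exp_add]
  simp only [neg_mul, neg_add_cancel, Real.exp_zero, one_smul, mul_one, mul_neg, neg_smul]
  rw [mul_comm γ (Real.exp (-(γ * t)))]
  abel

/-- Two solutions with the same data: the difference satisfies the equation integrated in time. -/
theorem ae_fourier_timeDeriv_sub_eq {γ : ℝ} {u₀ u₁ : L2 n} {u v : ℝ → L2 n}
    (hu : IsSolution γ u₀ u₁ u) (hv : IsSolution γ u₀ u₁ v) {D D' Y : ℝ → L2 n}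
    (hDc : Continuous D) (hD : ∀ t, 0 ≤ t → D t = v t - u t)
    (hD' : ∀ t, 0 ≤ t → D' t = timeDeriv v t - timeDeriv u t)
    (hY0 : Y 0 = 0)
    (hY : ∀ t, HasDerivAt Y (D t + D' t - memoryIntegral γ D t) t) {t : ℝ} (ht : 0 ≤ t) :
    ∀ᵐ ξ : Space n, (𝓕 (D' t) : L2 n) ξ = -((freqSq ξ : ℝ) : ℂ) * (𝓕 (Y t) : L2 n) ξ := by
  refine ae_fourier_eq_of_eq_laplacian fun φ => ?_
  rw [laplacian_pairing, ← pairCLM_apply]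
  -- `h` is the defect of the time-integrated equation: continuous up to 0, where it vanishes, with
  -- zero derivative in the interior.
  set h : ℝ → ℂ := fun τ => pairCLM φ (timeDeriv v τ) - pairCLM φ (timeDeriv u τ)
    - pairCLM (Δ φ) (Y τ) with hh
  have hYc : Continuous Y := continuous_iff_continuousAt.2 fun t => (hY t).continuousAt
  have hcont : ContinuousOn h (Icc 0 t) :=
    ((((pairCLM φ).continuous.comp_continuousOn hv.continuousOn_timeDeriv).sub
      ((pairCLM φ).continuous.comp_continuousOn hu.continuousOn_timeDeriv)).sub
      ((pairCLM (Δ φ)).continuous.comp hYc).continuousOn).mono Icc_subset_Ici_self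
  have hder : ∀ x ∈ Ioo 0 t, HasDerivWithinAt h 0 (Ioi x) x := fun x hx => by
    have h1 := (hv.equation φ x hx.1).sub (hu.equation φ x hx.1)
    have h2 := ((pairCLM (Δ φ)).restrictScalars ℝ).hasFDerivAt.comp_hasDerivAt x (hY x)
    have h3 := integral_exp_mul_eq (pairCLM (Δ φ))
      (fun t _ => (hasDerivAt_memoryIntegral (γ := γ) hDc t).hasDerivWithinAt)
      (by simp [memoryIntegral]) hDc.continuousOn hx.1.le
    have hint : ∀ w : ℝ → L2 n, ContinuousOn w (Ici 0) → IntervalIntegrable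
        (fun η => (Real.exp (-γ * (x - η)) : ℂ) * pairCLM (Δ φ) (w η)) volume 0 x := fun w hw => by
      refine ContinuousOn.intervalIntegrable_of_Icc hx.1.le (ContinuousOn.mul ?_
        ((pairCLM (Δ φ)).continuous.comp_continuousOn (hw.mono Icc_subset_Ici_self)))
      exact Continuous.continuousOn (by fun_prop)
    have h4 : ∫ η in (0 : ℝ)..x, (Real.exp (-γ * (x - η)) : ℂ) * pairCLM (Δ φ) (D η) =
        (∫ η in (0 : ℝ)..x, (Real.exp (-γ * (x - η)) : ℂ) * pairCLM (Δ φ) (v η))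
        - ∫ η in (0 : ℝ)..x, (Real.exp (-γ * (x - η)) : ℂ) * pairCLM (Δ φ) (u η) := by
      rw [← intervalIntegral.integral_sub (hint v hv.continuousOn) (hint u hu.continuousOn)]
      refine intervalIntegral.integral_congr fun η hη => ?_
      rw [uIcc_of_le hx.1.le] at hη
      simp only [hD η hη.1, map_sub, mul_sub]
    refine ((h1.sub h2).congr_deriv ?_).hasDerivWithinAt
    simp only [laplacian_pairing]
    simp only [ContinuousLinearMap.coe_restrictScalars', map_sub, map_add]
    rw [← h3, h4, hD x hx.1.le, hD' x hx.1.le]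
    simp only [map_sub]
    ring
  have h0 := intervalIntegral.integral_eq_sub_of_hasDeriv_right_of_le ht hcont hder
    intervalIntegrable_const
  have hz : h 0 = 0 := by
    simp [hh, hY0, hv.initial_velocity, hu.initial_velocity]
  rw [intervalIntegral.integral_zero, hz, sub_zero] at h0
  rw [hD' t ht, map_sub]
  exact sub_eq_zero.1 h0.symm

/-- The frequency content in `{ξ | |ξ|² ≤ R}`. -/
noncomputable def lowFreq (R : ℝ) :
    L2 n →L[ℂ] Lp ℂ 2 ((volume : Measure (Space n)).restrict {ξ | freqSq ξ ≤ R}) :=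
  (LpToLpRestrictCLM (Space n) ℂ ℂ volume 2 {ξ | freqSq ξ ≤ R}).comp (fourierCLM ℂ (L2 n))

theorem lowFreq_coeFn (R : ℝ) (f : L2 n) :
    lowFreq R f =ᵐ[(volume : Measure (Space n)).restrict {ξ | freqSq ξ ≤ R}] (𝓕 f : L2 n) :=
  LpToLpRestrictCLM_coeFn ℂ _ _

theorem norm_lowFreq_le_of_ae_eq {R : ℝ} {f g : L2 n}
    (h : ∀ᵐ ξ : Space n, (𝓕 f : L2 n) ξ = -((freqSq ξ : ℝ) : ℂ) * (𝓕 g : L2 n) ξ) :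
    ‖lowFreq R f‖ ≤ R * ‖lowFreq R g‖ := by
  have hS : MeasurableSet {ξ : Space n | freqSq ξ ≤ R} :=
    (isClosed_le continuous_freqSq continuous_const).measurableSet
  refine Lp.norm_le_mul_norm_of_ae_le_mul ?_
  filter_upwards [lowFreq_coeFn R f, lowFreq_coeFn R g, ae_restrict_of_ae h,
    ae_restrict_mem hS] with ξ h1 h2 h3 h4
  rw [h1, h2, h3, norm_mul, norm_neg, Complex.norm_real, Real.norm_of_nonneg (freqSq_nonneg ξ)]
  gcongr

theorem eq_zero_of_lowFreq_eq_zero {f : L2 n} (h : ∀ N : ℕ, lowFreq (N : ℝ) f = 0) : f = 0 := by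
  have h1 : ∀ᵐ ξ : Space n, ∀ N : ℕ, freqSq ξ ≤ N → (𝓕 f : L2 n) ξ = 0 := by
    rw [ae_all_iff]
    intro N
    have hS : MeasurableSet {ξ : Space n | freqSq ξ ≤ N} :=
      (isClosed_le continuous_freqSq continuous_const).measurableSet
    have h2 := lowFreq_coeFn (N : ℝ) f
    rw [h N] at h2
    refine (ae_restrict_iff' hS).1 ?_
    filter_upwards [h2, Lp.coeFn_zero ℂ 2
      ((volume : Measure (Space n)).restrict {ξ | freqSq ξ ≤ (N : ℝ)})] with ξ h3 h4
    rw [← h3, h4, Pi.zero_apply]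
  have h2 : (𝓕 f : L2 n) = 0 := by
    rw [Lp.eq_zero_iff_ae_eq_zero]
    filter_upwards [h1] with ξ h3
    obtain ⟨N, hN⟩ := exists_nat_ge (freqSq ξ)
    exact h3 N hN
  rw [← norm_eq_zero, ← Lp.norm_fourier_eq, h2, norm_zero]

/-- Below frequency M, 𝓕D' = −|ξ|² 𝓕Y bounds D' by M times Y, so the triple (D, N, Y) satisfies a
closed linear differential inequality with zero data. -/
theorem IsSolution.eqOn {γ : ℝ} (hγ : 0 ≤ γ) {u₀ u₁ : L2 n} {u v : ℝ → L2 n}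
    (hu : IsSolution γ u₀ u₁ u) (hv : IsSolution γ u₀ u₁ v) : EqOn v u (Ici 0) := by
  -- The difference is frozen for negative times, so that it is continuous on the whole line and its
  -- integrals are differentiable everywhere.
  have hmax : Continuous fun t : ℝ => max t 0 := continuous_id.max continuous_const
  have hmem : ∀ t : ℝ, max t 0 ∈ Ici (0 : ℝ) := fun t => le_max_right t 0
  set D : ℝ → L2 n := fun t => v (max t 0) - u (max t 0) with hDdef
  set D' : ℝ → L2 n := fun t => timeDeriv v (max t 0) - timeDeriv u (max t 0) with hDdef'
  have hD : ∀ t, 0 ≤ t → D t = v t - u t := fun t ht => by simp [hDdef, max_eq_left ht]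
  have hD' : ∀ t, 0 ≤ t → D' t = timeDeriv v t - timeDeriv u t := fun t ht => by
    simp [hDdef', max_eq_left ht]
  have hDc : Continuous D :=
    (hv.continuousOn.comp_continuous hmax hmem).sub (hu.continuousOn.comp_continuous hmax hmem)
  have hDc' : Continuous D' := (hv.continuousOn_timeDeriv.comp_continuous hmax hmem).sub
    (hu.continuousOn_timeDeriv.comp_continuous hmax hmem)
  have hDd : ∀ t, 0 ≤ t → HasDerivWithinAt D (D' t) (Ici t) t := fun t ht => by
    rw [hD' t ht]
    refine (((hv.hasDerivWithinAt ht).sub (hu.hasDerivWithinAt ht)).mono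
      (Ici_subset_Ici.2 ht)).congr (fun y hy => hD y (ht.trans hy)) (hD t ht)
  set N : ℝ → L2 n := memoryIntegral γ D with hN
  have hNd : ∀ t, HasDerivAt N (D t - (γ : ℂ) • N t) t := hasDerivAt_memoryIntegral hDc
  have hNc : Continuous N := continuous_iff_continuousAt.2 fun t => (hNd t).continuousAt
  set Y : ℝ → L2 n := fun t => ∫ η in (0 : ℝ)..t, (D η + D' η - N η) with hYdef
  have hYd : ∀ t, HasDerivAt Y (D t + D' t - N t) t := fun t =>
    (((hDc.add hDc').sub hNc).integral_hasStrictDerivAt 0 t).hasDerivAt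
  have hYc : Continuous Y := continuous_iff_continuousAt.2 fun t => (hYd t).continuousAt
  have hY0 : Y 0 = 0 := by simp [hYdef]
  have hN0 : N 0 = 0 := by simp [hN, memoryIntegral]
  have hD0 : D 0 = 0 := by
    rw [hD 0 le_rfl, hv.initial_value, hu.initial_value, sub_self]
  intro t ht
  have hzero : D t = 0 := by
    refine eq_zero_of_lowFreq_eq_zero fun M => ?_
    set ρ := (lowFreq (n := n) (M : ℝ)).restrictScalars ℝ with hρ
    set X := fun t => (ρ (D t), ρ (N t), ρ (Y t)) with hX
    have hXc : Continuous X := (ρ.continuous.comp hDc).prodMk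
      ((ρ.continuous.comp hNc).prodMk (ρ.continuous.comp hYc))
    have hM : (0 : ℝ) ≤ M := Nat.cast_nonneg M
    have hg := norm_le_gronwallBound_of_norm_deriv_right_le (f := X)
      (f' := fun t => (ρ (D' t), ρ (D t - (γ : ℂ) • N t), ρ (D t + D' t - N t)))
      -- The components of the derivative are bounded by M, 1 + γ and M + 2 times the norm; K
      -- dominates all three.
      (δ := 0) (K := M + γ + 2) (ε := 0) (a := 0) (b := t) hXc.continuousOn
      (fun x hx => (ρ.hasFDerivAt.comp_hasDerivWithinAt x (hDd x hx.1)).prodMk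
        ((ρ.hasFDerivAt.comp_hasDerivWithinAt x (hNd x).hasDerivWithinAt).prodMk
          (ρ.hasFDerivAt.comp_hasDerivWithinAt x (hYd x).hasDerivWithinAt)))
      (by simp [hX, hD0, hN0, hY0])
      (fun x hx => by
        have h1 : ‖ρ (D x)‖ ≤ ‖X x‖ := norm_fst_le (X x)
        have h2 : ‖ρ (N x)‖ ≤ ‖X x‖ := (norm_fst_le (X x).2).trans (norm_snd_le (X x))
        have h3 : ‖ρ (Y x)‖ ≤ ‖X x‖ := (norm_snd_le (X x).2).trans (norm_snd_le (X x))
        have h4 : ‖ρ (D' x)‖ ≤ M * ‖X x‖ := (norm_lowFreq_le_of_ae_eq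
          (ae_fourier_timeDeriv_sub_eq hu hv hDc hD hD' hY0 hYd hx.1)).trans (by gcongr; exact h3)
        have h5 : ‖ρ (D x - (γ : ℂ) • N x)‖ ≤ (1 + γ) * ‖X x‖ := by
          have h6 : ρ (D x - (γ : ℂ) • N x) = ρ (D x) - (γ : ℂ) • ρ (N x) := by
            change lowFreq (M : ℝ) (D x - (γ : ℂ) • N x) =
              lowFreq (M : ℝ) (D x) - (γ : ℂ) • lowFreq (M : ℝ) (N x)
            rw [map_sub, map_smul]
          rw [h6]
          refine (norm_sub_le _ _).trans ?_
          rw [norm_smul, Complex.norm_real, Real.norm_of_nonneg hγ, add_mul, one_mul]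
          gcongr
        have h7 : ‖ρ (D x + D' x - N x)‖ ≤ (M + 2) * ‖X x‖ := by
          rw [map_sub, map_add]
          have := norm_sub_le (ρ (D x) + ρ (D' x)) (ρ (N x))
          have := norm_add_le (ρ (D x)) (ρ (D' x))
          linarith
        have h0 := norm_nonneg (X x)
        have hγX := mul_nonneg hγ h0
        have hMX := mul_nonneg hM h0
        rw [add_zero, Prod.norm_def, Prod.norm_def]
        refine max_le (h4.trans ?_) (max_le (h5.trans ?_) (h7.trans ?_)) <;> linarith)
      t ⟨ht, le_rfl⟩
    rw [gronwallBound_ε0_δ0] at hg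
    have := norm_le_zero_iff.1 hg
    exact congrArg Prod.fst this
  rw [hD t ht] at hzero
  exact sub_eq_zero.1 hzero

/-! ### Gaussian moments in frequency -/

theorem exists_rpow_le_mul_exp {c : ℝ} (hc : 0 < c) (b : ℝ) :
    ∃ C, 0 < C ∧ ∀ y, 0 ≤ y → (1 + y) ^ b ≤ C * Real.exp (c * y) := by
  obtain ⟨N, hN⟩ := exists_nat_ge b
  refine ⟨N.factorial / c ^ N * Real.exp c, by positivity, fun y hy => ?_⟩
  have h1 : (1 + y) ^ b ≤ (1 + y) ^ N := by
    rw [← Real.rpow_natCast]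
    exact Real.rpow_le_rpow_of_exponent_le (by linarith) hN
  have h2 := Real.pow_div_factorial_le_exp (c * (1 + y)) (by positivity) N
  rw [div_le_iff₀ (by positivity), mul_pow] at h2
  calc (1 + y) ^ b ≤ (1 + y) ^ N := h1
    _ = (c ^ N * (1 + y) ^ N) / c ^ N := by field_simp
    _ ≤ (Real.exp (c * (1 + y)) * N.factorial) / c ^ N := by gcongr
    _ = _ := by rw [mul_add, mul_one, Real.exp_add]; ring

theorem integrable_exp_neg_mul_freqSq {c : ℝ} (hc : 0 < c) :
    Integrable fun ξ : Space n => Real.exp (-c * freqSq ξ) := by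
  have h := GaussianFourier.integrable_cexp_neg_mul_sq_norm_add (V := Space n)
    (b := ((c * (2 * Real.pi) ^ 2 : ℝ) : ℂ)) (by rw [Complex.ofReal_re]; positivity) 0 0
  refine h.norm.congr (Filter.Eventually.of_forall fun ξ => ?_)
  have : (-((c * (2 * Real.pi) ^ 2 : ℝ) : ℂ) * ((‖ξ‖ : ℝ) : ℂ) ^ 2 + 0 * ((inner ℝ 0 ξ : ℝ) : ℂ)) =
      ((-c * freqSq ξ : ℝ) : ℂ) := by
    simp only [freqSq]; push_cast; ring
  simp only []
  rw [this, ← Complex.ofReal_exp, Complex.norm_real, Real.norm_of_nonneg (Real.exp_pos _).le]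

theorem integrable_rpow_mul_exp {c a : ℝ} (hc : 0 < c) (ha : 0 ≤ a) :
    Integrable fun ξ : Space n => (2 * Real.pi * ‖ξ‖) ^ a * Real.exp (-c * freqSq ξ) := by
  -- Half of the Gaussian exponent absorbs the power; the other half remains integrable.
  obtain ⟨C, hC, h⟩ := exists_rpow_le_mul_exp (half_pos hc) (a / 2)
  have hm : Continuous fun ξ : Space n =>
      (2 * Real.pi * ‖ξ‖) ^ a * Real.exp (-c * freqSq ξ) := by
    have h1 : Continuous fun ξ : Space n => (2 * Real.pi * ‖ξ‖) ^ a :=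
      (continuous_const.mul continuous_norm).rpow_const fun _ => Or.inr ha
    exact h1.mul (continuous_const.mul continuous_freqSq).rexp
  refine ((integrable_exp_neg_mul_freqSq (half_pos hc)).const_mul C).mono'
    hm.aestronglyMeasurable (Filter.Eventually.of_forall fun ξ => ?_)
  have hx : 0 ≤ 2 * Real.pi * ‖ξ‖ := by positivity
  rw [Real.norm_of_nonneg (by positivity)]
  have h1 : (2 * Real.pi * ‖ξ‖) ^ a ≤ (1 + freqSq ξ) ^ (a / 2) := by
    have : (2 * Real.pi * ‖ξ‖) ^ a = freqSq ξ ^ (a / 2) := by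
      rw [freqSq, ← Real.rpow_natCast, ← Real.rpow_mul hx]
      congr 1; push_cast; ring
    rw [this]
    exact Real.rpow_le_rpow (freqSq_nonneg ξ) (by linarith) (by positivity)
  calc _ ≤ C * Real.exp (c / 2 * freqSq ξ) * Real.exp (-c * freqSq ξ) := by
        gcongr; exact h1.trans (h _ (freqSq_nonneg ξ))
    _ = _ := by rw [mul_assoc, ← Real.exp_add]; congr 2; ring

/-- Moments of a Gaussian in the frequency variable. -/
noncomputable def gaussMoment (n : ℕ) (c a : ℝ) : ℝ :=
  ∫ ξ : Space n, (2 * Real.pi * ‖ξ‖) ^ a * Real.exp (-c * freqSq ξ)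

theorem gaussMoment_nonneg (n : ℕ) (c a : ℝ) : 0 ≤ gaussMoment n c a :=
  integral_nonneg fun ξ => by positivity

/-- Under ξ ↦ √T ξ the power gives T^(−a/2) and the Jacobian T^(−n/2). This is the source of all
polynomial rates. -/
theorem gaussMoment_mul {c T : ℝ} (a : ℝ) (hT : 0 < T) :
    gaussMoment n (c * T) a = T ^ (-(a / 2) - (n : ℝ) / 2) * gaussMoment n c a := by
  have hR : 0 < √T := Real.sqrt_pos.2 hT
  have h := Measure.integral_comp_smul (volume : Measure (Space n))
    (fun ξ => (2 * Real.pi * ‖ξ‖) ^ a * Real.exp (-c * freqSq ξ)) (√T)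
  have h1 : ∀ ξ : Space n, (2 * Real.pi * ‖√T • ξ‖) ^ a * Real.exp (-c * freqSq (√T • ξ)) =
      √T ^ a * ((2 * Real.pi * ‖ξ‖) ^ a * Real.exp (-(c * T) * freqSq ξ)) := fun ξ => by
    have h2 : 2 * Real.pi * ‖√T • ξ‖ = √T * (2 * Real.pi * ‖ξ‖) := by
      rw [norm_smul, Real.norm_of_nonneg hR.le]; ring
    have h3 : freqSq (√T • ξ) = T * freqSq ξ := by
      rw [freqSq, h2, mul_pow, Real.sq_sqrt hT.le, freqSq]
    rw [h3, h2, Real.mul_rpow hR.le (by positivity)]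
    rw [mul_assoc]
    congr 3
    ring
  simp only [h1] at h
  rw [integral_const_mul, finrank_euclideanSpace_fin, abs_of_pos (by positivity), smul_eq_mul] at h
  have h4 : √T ^ a * gaussMoment n (c * T) a = (√T ^ n)⁻¹ * gaussMoment n c a := h
  have h5 : T ^ (-(a / 2) - (n : ℝ) / 2) = (√T ^ a)⁻¹ * (√T ^ n)⁻¹ := by
    rw [sub_eq_add_neg, Real.rpow_add hT, Real.rpow_neg hT.le, Real.rpow_neg hT.le,
      ← Real.rpow_natCast (√T) n, Real.sqrt_eq_rpow, ← Real.rpow_mul hT.le, ← Real.rpow_mul hT.le]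
    congr 3 <;> ring
  have h6 : 0 < √T ^ a := by positivity
  rw [h5, mul_assoc, ← h4, inv_mul_cancel_left₀ h6.ne']

/-! ### Pointwise bounds on the velocity in frequency -/

/-- Energy decay with ρ = r. The mode carrying u₀ starts with energy r and the one carrying u₁ with
energy 1; the extra factor r is the additional half power of decay for u₀. -/
theorem norm_modeSum_velocity_sq_le_of_freqSq_le_one {γ : ℝ} (hγ : 1 < γ) (f g : Space n → ℂ)
    {t : ℝ} (ht : 0 ≤ t) {ξ : Space n} (hξ : freqSq ξ ≤ 1) :
    ‖modeSum γ (fun x => x.2.1) f g t ξ‖ ^ 2 ≤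
      8 * Real.exp (-((1 - γ⁻¹) / 4 * freqSq ξ) * t) * (freqSq ξ * ‖f ξ‖ ^ 2 + ‖g ξ‖ ^ 2) := by
  have hγ0 : 0 < γ := by linarith
  have hk0 : 0 < 1 - γ⁻¹ := by have := inv_lt_one_of_one_lt₀ hγ; linarith
  have hr := freqSq_nonneg ξ
  set r := freqSq ξ with hrdef
  set e := Real.exp (-((1 - γ⁻¹) / 4 * r) * t) with he
  have he0 : 0 < e := Real.exp_pos _
  have hA := (isMode_modeFlow γ r (modeA γ)).energy_decay hγ hr hξ le_rfl ht
  have hB := (isMode_modeFlow γ r modeB).energy_decay hγ hr hξ le_rfl ht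
  have hA0 : (modeFlow γ r 0 (modeA γ)).2.1 ^ 2 + r * ((1 - γ⁻¹) * (modeFlow γ r 0 (modeA γ)).1 ^ 2
      + γ * (modeFlow γ r 0 (modeA γ)).2.2 ^ 2) = r := by
    rw [modeFlow_zero, modeA]
    field_simp
    ring
  have hB0 : (modeFlow γ r 0 modeB).2.1 ^ 2 + r * ((1 - γ⁻¹) * (modeFlow γ r 0 modeB).1 ^ 2
      + γ * (modeFlow γ r 0 modeB).2.2 ^ 2) = 1 := by
    rw [modeFlow_zero, modeB]
    norm_num
  rw [hA0] at hA
  rw [hB0] at hB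
  set a := modeFlow γ r t (modeA γ)
  set b := modeFlow γ r t modeB
  have ha : a.2.1 ^ 2 ≤ 4 * e * r := by
    have : 0 ≤ r * ((1 - γ⁻¹) * a.1 ^ 2 + γ * a.2.2 ^ 2) := by positivity
    linarith
  have hb : b.2.1 ^ 2 ≤ 4 * e * 1 := by
    have : 0 ≤ r * ((1 - γ⁻¹) * b.1 ^ 2 + γ * b.2.2 ^ 2) := by positivity
    linarith
  have h1 : ‖modeSum γ (fun x => x.2.1) f g t ξ‖ ≤ |a.2.1| * ‖f ξ‖ + |b.2.1| * ‖g ξ‖ := by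
    unfold modeSum
    refine (norm_add_le _ _).trans ?_
    rw [norm_mul, norm_mul, Complex.norm_real, Complex.norm_real]
    rfl
  calc _ ≤ (|a.2.1| * ‖f ξ‖ + |b.2.1| * ‖g ξ‖) ^ 2 := by gcongr
    _ ≤ 2 * ((|a.2.1| * ‖f ξ‖) ^ 2 + (|b.2.1| * ‖g ξ‖) ^ 2) := add_sq_le
    _ = 2 * (a.2.1 ^ 2 * ‖f ξ‖ ^ 2 + b.2.1 ^ 2 * ‖g ξ‖ ^ 2) := by
        rw [mul_pow, mul_pow, sq_abs, sq_abs]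
    _ ≤ 2 * (4 * e * r * ‖f ξ‖ ^ 2 + 4 * e * 1 * ‖g ξ‖ ^ 2) := by gcongr
    _ = _ := by ring

theorem norm_modeSum_velocity_sq_le_of_one_le_freqSq {γ : ℝ} (hγ : 1 < γ) (f g : Space n → ℂ)
    {t : ℝ} (ht : 0 ≤ t) {ξ : Space n} (hξ : 1 ≤ freqSq ξ) :
    ‖modeSum γ (fun x => x.2.1) f g t ξ‖ ^ 2 ≤
      34 * Real.exp (-((1 - γ⁻¹) / 4) * t) * (‖f ξ‖ ^ 2 + ‖g ξ‖ ^ 2) := by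
  have ha := (isMode_modeFlow γ (freqSq ξ) (modeA γ)).velocity_sq_le_of_one_le hγ hξ
    (modeA_energy hγ) ht
  have hb := (isMode_modeFlow γ (freqSq ξ) modeB).velocity_sq_le_of_one_le hγ hξ modeB_energy ht
  set r := freqSq ξ
  set e := Real.exp (-((1 - γ⁻¹) / 4) * t) with he
  set a := modeFlow γ r t (modeA γ)
  set b := modeFlow γ r t modeB
  have h1 : ‖modeSum γ (fun x => x.2.1) f g t ξ‖ ≤ |a.2.1| * ‖f ξ‖ + |b.2.1| * ‖g ξ‖ := by
    unfold modeSum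
    refine (norm_add_le _ _).trans ?_
    rw [norm_mul, norm_mul, Complex.norm_real, Complex.norm_real]
    rfl
  calc _ ≤ (|a.2.1| * ‖f ξ‖ + |b.2.1| * ‖g ξ‖) ^ 2 := by gcongr
    _ ≤ 2 * ((|a.2.1| * ‖f ξ‖) ^ 2 + (|b.2.1| * ‖g ξ‖) ^ 2) := add_sq_le
    _ = 2 * (a.2.1 ^ 2 * ‖f ξ‖ ^ 2 + b.2.1 ^ 2 * ‖g ξ‖ ^ 2) := by
        rw [mul_pow, mul_pow, sq_abs, sq_abs]
    _ ≤ 2 * (17 * e * ‖f ξ‖ ^ 2 + 17 * e * ‖g ξ‖ ^ 2) := by gcongr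
    _ = _ := by ring

theorem MemL11.ae_norm_fourier_sq_le {f : L2 n} (hf : MemL11 f) :
    ∀ᵐ ξ : Space n, ‖(𝓕 f : L2 n) ξ‖ ^ 2 ≤
      2 * (‖mean f‖ ^ 2 + freqSq ξ * normL11 f ^ 2) := by
  filter_upwards [ae_fourier_eq_fourierIntegral hf.integrable] with ξ hξ
  rw [hξ]
  have h1 := hf.norm_fourier_sub_mean_le ξ
  have h2 : ‖𝓕 (f : Space n → ℂ) ξ‖ ≤ ‖mean f‖ + 2 * Real.pi * ‖ξ‖ * normL11 f := by
    have := norm_sub_norm_le (𝓕 (f : Space n → ℂ) ξ) (mean f)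
    linarith
  calc _ ≤ (‖mean f‖ + 2 * Real.pi * ‖ξ‖ * normL11 f) ^ 2 := by gcongr
    _ ≤ 2 * (‖mean f‖ ^ 2 + (2 * Real.pi * ‖ξ‖ * normL11 f) ^ 2) := add_sq_le
    _ = _ := by rw [mul_pow, freqSq]

/-- |ξ|^(2s) ≤ (1 + |ξ|²)^s; the power of 2π comes from the frequency normalization. -/
theorem rpow_sq_mul_norm_fourier_sq_le {s : ℝ} (hs : 0 ≤ s) {f h : L2 n}
    (H : besselPotential (Space n) ℂ s (f : 𝓢'(Space n, ℂ)) = (h : 𝓢'(Space n, ℂ))) :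
    ∀ᵐ ξ : Space n, (2 * Real.pi * ‖ξ‖) ^ (2 * s) * ‖(𝓕 f : L2 n) ξ‖ ^ 2 ≤
      (2 * Real.pi) ^ (2 * s) * ‖(𝓕 h : L2 n) ξ‖ ^ 2 := by
  filter_upwards [ae_fourier_eq_of_besselPotential_eq H] with ξ hξ
  rw [hξ, norm_mul, Complex.norm_real, Real.norm_of_nonneg (by positivity), mul_pow, ← mul_assoc]
  gcongr
  rw [Real.mul_rpow Real.two_pi_pos.le (norm_nonneg ξ)]
  gcongr
  rw [← Real.rpow_natCast ((1 + ‖ξ‖ ^ 2) ^ (s / 2)), ← Real.rpow_mul (by positivity),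
    Real.rpow_mul (norm_nonneg ξ) 2 s]
  have h1 : s / 2 * ((2 : ℕ) : ℝ) = s := by push_cast; ring
  rw [h1, Real.rpow_two]
  exact Real.rpow_le_rpow (by positivity) (by linarith) hs

theorem rpow_mul_norm_modeSum_velocity_sq_le {γ s : ℝ} (hγ : 1 < γ) (hs : 0 ≤ s)
    {f g : Space n → ℂ} {t P₀ P₁ N₀ N₁ H₀ H₁ : ℝ} (ht : 0 ≤ t) {ξ : Space n}
    (hf : ‖f ξ‖ ^ 2 ≤ 2 * (P₀ ^ 2 + freqSq ξ * N₀ ^ 2))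
    (hg : ‖g ξ‖ ^ 2 ≤ 2 * (P₁ ^ 2 + freqSq ξ * N₁ ^ 2))
    (hf' : (2 * Real.pi * ‖ξ‖) ^ (2 * s) * ‖f ξ‖ ^ 2 ≤ H₀)
    (hg' : (2 * Real.pi * ‖ξ‖) ^ (2 * s) * ‖g ξ‖ ^ 2 ≤ H₁) :
    (2 * Real.pi * ‖ξ‖) ^ (2 * s) * ‖modeSum γ (fun x => x.2.1) f g t ξ‖ ^ 2 ≤
      16 * Real.exp ((1 - γ⁻¹) / 4) *
        ((2 * Real.pi * ‖ξ‖) ^ (2 * s + 2) * Real.exp (-((1 - γ⁻¹) / 4 * (1 + t)) * freqSq ξ) *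
            (P₀ ^ 2 + N₁ ^ 2)
          + (2 * Real.pi * ‖ξ‖) ^ (2 * s + 4) * Real.exp (-((1 - γ⁻¹) / 4 * (1 + t)) * freqSq ξ) *
            N₀ ^ 2
          + (2 * Real.pi * ‖ξ‖) ^ (2 * s) * Real.exp (-((1 - γ⁻¹) / 4 * (1 + t)) * freqSq ξ) *
            P₁ ^ 2)
      + 34 * Real.exp (-((1 - γ⁻¹) / 4) * t) * (H₀ + H₁) := by
  have hk0 : 0 < 1 - γ⁻¹ := by have := inv_lt_one_of_one_lt₀ hγ; linarith
  have hx : 0 ≤ 2 * Real.pi * ‖ξ‖ := by positivity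
  have hX : 0 ≤ (2 * Real.pi * ‖ξ‖) ^ (2 * s) := by positivity
  have hH₀ : 0 ≤ H₀ := le_trans (by positivity) hf'
  have hH₁ : 0 ≤ H₁ := le_trans (by positivity) hg'
  rcases le_total (freqSq ξ) 1 with hξ | hξ
  · have h := norm_modeSum_velocity_sq_le_of_freqSq_le_one hγ f g ht hξ
    have hr := freqSq_nonneg ξ
    have e2 : (2 * Real.pi * ‖ξ‖) ^ (2 * s + 2) = (2 * Real.pi * ‖ξ‖) ^ (2 * s) * freqSq ξ := by
      rw [Real.rpow_add_of_nonneg hx (by positivity) (by norm_num), Real.rpow_two, freqSq]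
    have e4 : (2 * Real.pi * ‖ξ‖) ^ (2 * s + 4) =
        (2 * Real.pi * ‖ξ‖) ^ (2 * s) * (freqSq ξ * freqSq ξ) := by
      rw [Real.rpow_add_of_nonneg hx (by positivity) (by norm_num), freqSq]
      congr 1
      have : (4 : ℝ) = ((4 : ℕ) : ℝ) := by norm_num
      rw [this, Real.rpow_natCast]
      ring
    rw [e2, e4]
    -- As |ξ|² ≤ 1, replacing t by 1 + t costs only a constant factor and avoids the singularity of
    -- the moments at t = 0.
    have hexp : Real.exp (-((1 - γ⁻¹) / 4 * freqSq ξ) * t) ≤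
        Real.exp ((1 - γ⁻¹) / 4) * Real.exp (-((1 - γ⁻¹) / 4 * (1 + t)) * freqSq ξ) := by
      rw [← Real.exp_add]
      apply Real.exp_le_exp.2
      nlinarith
    set r := freqSq ξ
    set X := (2 * Real.pi * ‖ξ‖) ^ (2 * s)
    set E := Real.exp (-((1 - γ⁻¹) / 4 * (1 + t)) * r)
    calc X * ‖modeSum γ (fun x => x.2.1) f g t ξ‖ ^ 2
        ≤ X * (8 * Real.exp (-((1 - γ⁻¹) / 4 * r) * t) * (r * ‖f ξ‖ ^ 2 + ‖g ξ‖ ^ 2)) := by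
          gcongr
      _ ≤ X * (8 * (Real.exp ((1 - γ⁻¹) / 4) * E) *
            (r * (2 * (P₀ ^ 2 + r * N₀ ^ 2)) + 2 * (P₁ ^ 2 + r * N₁ ^ 2))) := by
          gcongr
      _ = 16 * Real.exp ((1 - γ⁻¹) / 4) * (X * r * E * (P₀ ^ 2 + N₁ ^ 2)
            + X * (r * r) * E * N₀ ^ 2 + X * E * P₁ ^ 2) := by ring
      _ ≤ _ := le_add_of_nonneg_right (by positivity)
  · have h := norm_modeSum_velocity_sq_le_of_one_le_freqSq hγ f g ht hξ
    set X := (2 * Real.pi * ‖ξ‖) ^ (2 * s)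
    set e := Real.exp (-((1 - γ⁻¹) / 4) * t)
    calc X * ‖modeSum γ (fun x => x.2.1) f g t ξ‖ ^ 2
        ≤ X * (34 * e * (‖f ξ‖ ^ 2 + ‖g ξ‖ ^ 2)) := by gcongr
      _ = 34 * e * (X * ‖f ξ‖ ^ 2 + X * ‖g ξ‖ ^ 2) := by ring
      _ ≤ 34 * e * (H₀ + H₁) := by gcongr
      _ ≤ _ := le_add_of_nonneg_left (by positivity)

/-! ### Decay of |D|^s u_t in L² -/

/-- The operator `|D|^s` applied to the velocity, with an energy bound by Gaussian moments. -/
theorem exists_absDPow_timeDeriv {γ s : ℝ} (hγ : 1 < γ) (hs : 0 ≤ s) {u₀ u₁ : L2 n}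
    (h₀ : MemHs s u₀) (l₀ : MemL11 u₀) (h₁ : MemHs s u₁) (l₁ : MemL11 u₁) {t : ℝ} (ht : 0 ≤ t) :
    ∃ w : L2 n, IsAbsDPow s (timeDeriv (solution γ u₀ u₁) t) w ∧
      ‖w‖ ^ 2 ≤ 16 * Real.exp ((1 - γ⁻¹) / 4) *
        (gaussMoment n ((1 - γ⁻¹) / 4 * (1 + t)) (2 * s + 2) * (‖mean u₀‖ ^ 2 + normL11 u₁ ^ 2)
          + gaussMoment n ((1 - γ⁻¹) / 4 * (1 + t)) (2 * s + 4) * normL11 u₀ ^ 2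
          + gaussMoment n ((1 - γ⁻¹) / 4 * (1 + t)) (2 * s) * ‖mean u₁‖ ^ 2)
      + 34 * Real.exp (-((1 - γ⁻¹) / 4) * t) *
        ((2 * Real.pi) ^ (2 * s) * normHs s u₀ ^ 2 + (2 * Real.pi) ^ (2 * s) * normHs s u₁ ^ 2) := by
  have hk0 : 0 < 1 - γ⁻¹ := by have := inv_lt_one_of_one_lt₀ hγ; linarith
  have hcT : 0 < (1 - γ⁻¹) / 4 * (1 + t) := by positivity
  obtain ⟨k₀, hk₀⟩ := h₀
  obtain ⟨k₁, hk₁⟩ := h₁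
  rw [normHs_eq hk₀, normHs_eq hk₁]
  set c := (1 - γ⁻¹) / 4 with hc
  set G : ℝ → Space n → ℝ := fun a ξ =>
    (2 * Real.pi * ‖ξ‖) ^ a * Real.exp (-(c * (1 + t)) * freqSq ξ) with hG
  set V := modeSum γ (fun x => x.2.1) (𝓕 u₀ : L2 n) (𝓕 u₁ : L2 n) t with hV
  set W : Space n → ℂ := fun ξ => (((2 * Real.pi * ‖ξ‖) ^ s : ℝ) : ℂ) * V ξ with hW
  set Q : ℝ := (2 * Real.pi) ^ (2 * s) with hQ
  set B : Space n → ℝ := fun ξ => 16 * Real.exp c * (G (2 * s + 2) ξ * (‖mean u₀‖ ^ 2 +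
      normL11 u₁ ^ 2) + G (2 * s + 4) ξ * normL11 u₀ ^ 2 + G (2 * s) ξ * ‖mean u₁‖ ^ 2)
    + 34 * Real.exp (-c * t) * (Q * ‖(𝓕 k₀ : L2 n) ξ‖ ^ 2 + Q * ‖(𝓕 k₁ : L2 n) ξ‖ ^ 2) with hB
  have hGi : ∀ a, 0 ≤ a → Integrable (G a) := fun a ha => integrable_rpow_mul_exp hcT ha
  have hA2 := (hGi (2 * s + 2) (by positivity)).mul_const (‖mean u₀‖ ^ 2 + normL11 u₁ ^ 2)
  have hA4 := (hGi (2 * s + 4) (by positivity)).mul_const (normL11 u₀ ^ 2)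
  have hA0 := (hGi (2 * s) (by positivity)).mul_const (‖mean u₁‖ ^ 2)
  have hK0 := (integrable_norm_sq_L2 (𝓕 k₀ : L2 n)).const_mul Q
  have hK1 := (integrable_norm_sq_L2 (𝓕 k₁ : L2 n)).const_mul Q
  have hBi : Integrable B :=
    (((hA2.add hA4).add hA0).const_mul _).add ((hK0.add hK1).const_mul _)
  have hBint : ∫ ξ, B ξ = 16 * Real.exp c *
        (gaussMoment n (c * (1 + t)) (2 * s + 2) * (‖mean u₀‖ ^ 2 + normL11 u₁ ^ 2)
          + gaussMoment n (c * (1 + t)) (2 * s + 4) * normL11 u₀ ^ 2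
          + gaussMoment n (c * (1 + t)) (2 * s) * ‖mean u₁‖ ^ 2)
      + 34 * Real.exp (-c * t) * (Q * ‖k₀‖ ^ 2 + Q * ‖k₁‖ ^ 2) := by
    refine (integral_add (((hA2.add hA4).add hA0).const_mul (16 * Real.exp c))
      ((hK0.add hK1).const_mul (34 * Real.exp (-c * t)))).trans ?_
    rw [integral_const_mul, integral_const_mul, integral_add' (hA2.add hA4) hA0,
      integral_add' hA2 hA4, integral_add' hK0 hK1, integral_mul_const, integral_mul_const,
      integral_mul_const, integral_const_mul, integral_const_mul, ← norm_sq_L2, ← norm_sq_L2,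
      Lp.norm_fourier_eq, Lp.norm_fourier_eq]
    rfl
  have hle : ∀ᵐ ξ, ‖W ξ‖ ^ 2 ≤ B ξ := by
    filter_upwards [l₀.ae_norm_fourier_sq_le, l₁.ae_norm_fourier_sq_le,
      rpow_sq_mul_norm_fourier_sq_le hs hk₀, rpow_sq_mul_norm_fourier_sq_le hs hk₁]
      with ξ a1 a2 a3 a4
    have h := rpow_mul_norm_modeSum_velocity_sq_le hγ hs ht a1 a2 a3 a4
    refine le_trans (le_of_eq ?_) h
    have hx : 0 ≤ 2 * Real.pi * ‖ξ‖ := by positivity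
    rw [hW, norm_mul, mul_pow, Complex.norm_real, Real.norm_of_nonneg (by positivity),
      ← Real.rpow_natCast, ← Real.rpow_mul hx, mul_comm s]
    rfl
  have hWm : AEStronglyMeasurable W volume := by
    have h1 : Continuous fun ξ : Space n => (((2 * Real.pi * ‖ξ‖) ^ s : ℝ) : ℂ) :=
      Complex.continuous_ofReal.comp
        ((continuous_const.mul continuous_norm).rpow_const fun _ => Or.inr hs)
    exact h1.aestronglyMeasurable.mul
      (aestronglyMeasurable_modeSum γ (by fun_prop) (𝓕 u₀ : L2 n) (𝓕 u₁ : L2 n) t)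
  have hWi : Integrable fun ξ => ‖W ξ‖ ^ 2 := hBi.mono' (hWm.norm.pow 2) (by
    filter_upwards [hle] with ξ h
    rw [Real.norm_of_nonneg (by positivity)]
    exact h)
  have hWL : MemLp W 2 volume := (memLp_two_iff_integrable_sq_norm hWm).2 hWi
  refine ⟨𝓕⁻ (hWL.toLp W), ?_, ?_⟩
  · rw [IsAbsDPow, fourier_fourierInv_eq, timeDeriv_solution hγ u₀ u₁ ht, fourier_fourierInv_eq]
    filter_upwards [hWL.coeFn_toLp, velocityL2_coeFn hγ (𝓕 u₀) (𝓕 u₁) ht] with ξ h1 h2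
    rw [h1, h2]
  · rw [← Lp.norm_fourier_eq, fourier_fourierInv_eq, norm_sq_L2, ← hBint]
    calc _ = ∫ ξ, ‖W ξ‖ ^ 2 := integral_congr_ae (by
          filter_upwards [hWL.coeFn_toLp] with ξ h1
          rw [h1])
      _ ≤ _ := integral_mono_ae hWi hBi hle

theorem normHs_nonneg (s : ℝ) (f : L2 n) : 0 ≤ normHs s f := by
  unfold normHs
  split_ifs
  · exact norm_nonneg _
  · exact le_rfl

theorem normL11_nonneg (f : L2 n) : 0 ≤ normL11 f :=
  integral_nonneg fun x => by positivity

/-- Each square on the left is matched with one of six nonnegative summands on the right, and a sum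
of squares is at most the square of the sum. The summand 1 makes the constant at least 1, so that it
also bounds its own square root. -/
theorem weighted_sq_sum_le {e A Q K₀ K₂ K₄ α β δ P₀ P₁ N₀ N₁ H₀ H₁ E : ℝ} (he : 0 ≤ e) (hA : 0 ≤ A)
    (hQ : 0 ≤ Q) (hK₀ : 0 ≤ K₀) (hK₂ : 0 ≤ K₂) (hK₄ : 0 ≤ K₄) (hα : 0 ≤ α) (hβ : 0 ≤ β)
    (hδ : 0 ≤ δ) (hαβ : α ^ 2 ≤ β ^ 2) (hE : E ≤ A * α ^ 2) (hP₀ : 0 ≤ P₀) (hP₁ : 0 ≤ P₁)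
    (hN₀ : 0 ≤ N₀) (hN₁ : 0 ≤ N₁) (hH₀ : 0 ≤ H₀) (hH₁ : 0 ≤ H₁) :
    e * (β ^ 2 * K₂ * (P₀ ^ 2 + N₁ ^ 2) + α ^ 2 * K₄ * N₀ ^ 2 + δ ^ 2 * K₀ * P₁ ^ 2)
        + 34 * E * (Q * H₀ ^ 2 + Q * H₁ ^ 2) ≤
      (e * (K₀ + K₂ + K₄) + 34 * A * Q + 1) *
        (α * (H₀ + N₀) + β * P₀ + β * (H₁ + N₁) + δ * P₁) ^ 2 := by
  have p0 : 0 ≤ e * K₀ := by positivity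
  have p2 : 0 ≤ e * K₂ := by positivity
  have p4 : 0 ≤ e * K₄ := by positivity
  have pA : 0 ≤ 34 * A * Q := by positivity
  obtain ⟨M, hM⟩ : ∃ M, M = e * (K₀ + K₂ + K₄) + 34 * A * Q + 1 := ⟨_, rfl⟩
  rw [← hM]
  have m0 : e * K₀ ≤ M := by linarith
  have m2 : e * K₂ ≤ M := by linarith
  have m4 : e * K₄ ≤ M := by linarith
  have mA : 34 * A * Q ≤ M := by linarith
  have hM0 : 0 ≤ M := p0.trans m0
  have add_sq_le_sq : ∀ x y : ℝ, 0 ≤ x → 0 ≤ y → x ^ 2 + y ^ 2 ≤ (x + y) ^ 2 :=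
    fun x y hx hy => by nlinarith [mul_nonneg hx hy]
  have a1 : 0 ≤ α * H₀ := by positivity
  have a2 : 0 ≤ α * N₀ := by positivity
  have a3 : 0 ≤ β * P₀ := by positivity
  have a4 : 0 ≤ β * H₁ := by positivity
  have a5 : 0 ≤ β * N₁ := by positivity
  have a6 : 0 ≤ δ * P₁ := by positivity
  have b2 := add_sq_le_sq _ _ a1 a2
  have b3 := add_sq_le_sq _ _ (add_nonneg a1 a2) a3
  have b4 := add_sq_le_sq _ _ (add_nonneg (add_nonneg a1 a2) a3) a4
  have b5 := add_sq_le_sq _ _ (add_nonneg (add_nonneg (add_nonneg a1 a2) a3) a4) a5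
  have b6 := add_sq_le_sq _ _
    (add_nonneg (add_nonneg (add_nonneg (add_nonneg a1 a2) a3) a4) a5) a6
  calc _ ≤ e * (β ^ 2 * K₂ * (P₀ ^ 2 + N₁ ^ 2) + α ^ 2 * K₄ * N₀ ^ 2 + δ ^ 2 * K₀ * P₁ ^ 2)
          + 34 * (A * α ^ 2) * (Q * H₀ ^ 2 + Q * H₁ ^ 2) := by gcongr
    _ = (e * K₂) * (β ^ 2 * (P₀ ^ 2 + N₁ ^ 2)) + (e * K₄) * (α ^ 2 * N₀ ^ 2)
        + (e * K₀) * (δ ^ 2 * P₁ ^ 2) + (34 * A * Q) * (α ^ 2 * H₀ ^ 2 + α ^ 2 * H₁ ^ 2) := by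
        ring
    _ ≤ M * (β ^ 2 * (P₀ ^ 2 + N₁ ^ 2)) + M * (α ^ 2 * N₀ ^ 2)
        + M * (δ ^ 2 * P₁ ^ 2) + M * (α ^ 2 * H₀ ^ 2 + β ^ 2 * H₁ ^ 2) := by gcongr
    _ = M * ((α * H₀) ^ 2 + (α * N₀) ^ 2 + (β * P₀) ^ 2 + (β * H₁) ^ 2 + (β * N₁) ^ 2
        + (δ * P₁) ^ 2) := by ring
    _ ≤ M * (α * H₀ + α * N₀ + β * P₀ + β * H₁ + β * N₁ + δ * P₁) ^ 2 := by
        gcongr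
        linarith
    _ = _ := by ring

theorem le_mul_of_sq_le {y M S : ℝ} (hM : 1 ≤ M) (hS : 0 ≤ S) (h : y ^ 2 ≤ M * S ^ 2) :
    y ≤ M * S := by
  refine le_of_sq_le_sq ?_ (mul_nonneg (by linarith) hS)
  calc y ^ 2 ≤ M * S ^ 2 := h
    _ ≤ M ^ 2 * S ^ 2 := mul_le_mul_of_nonneg_right (by nlinarith) (sq_nonneg S)
    _ = (M * S) ^ 2 := (mul_pow M S 2).symm

/-- The exponent s + 2 + d/2 is twice that of the fastest rate, so the high frequency exponential is
absorbed into it. -/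
theorem decay_rates {c A s : ℝ} (d : ℝ)
    (hA : ∀ y, 0 ≤ y → (1 + y) ^ (s + 2 + d / 2) ≤ A * Real.exp (c * y)) {t : ℝ} (ht : 0 ≤ t) :
    ((1 + t) ^ (-((s + 2) / 2) - d / 4)) ^ 2 ≤ ((1 + t) ^ (-((s + 1) / 2) - d / 4)) ^ 2 ∧
    Real.exp (-c * t) ≤ A * ((1 + t) ^ (-((s + 2) / 2) - d / 4)) ^ 2 ∧
    (1 + t) ^ (-((2 * s + 4) / 2) - d / 2) = ((1 + t) ^ (-((s + 2) / 2) - d / 4)) ^ 2 ∧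
    (1 + t) ^ (-((2 * s + 2) / 2) - d / 2) = ((1 + t) ^ (-((s + 1) / 2) - d / 4)) ^ 2 ∧
    (1 + t) ^ (-((2 * s) / 2) - d / 2) = ((1 + t) ^ (-(s / 2) - d / 4)) ^ 2 := by
  have hT : 0 < 1 + t := by linarith
  have hT1 : 1 ≤ 1 + t := by linarith
  have hsq : ∀ y : ℝ, ((1 + t) ^ y) ^ 2 = (1 + t) ^ (2 * y) := fun y => by
    rw [← Real.rpow_natCast, ← Real.rpow_mul hT.le, mul_comm]
    norm_num
  simp only [hsq]
  refine ⟨Real.rpow_le_rpow_of_exponent_le hT1 (by linarith), ?_, ?_, ?_, ?_⟩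
  · have h2 : (1 + t) ^ (2 * (-((s + 2) / 2) - d / 4)) = ((1 + t) ^ (s + 2 + d / 2))⁻¹ := by
      rw [← Real.rpow_neg hT.le]; congr 1; ring
    rw [h2, ← div_eq_mul_inv, le_div_iff₀ (by positivity), neg_mul, Real.exp_neg,
      inv_mul_le_iff₀ (Real.exp_pos _), mul_comm]
    exact hA t ht
  all_goals congr 1; ring

/-- Decay of `|D|^s u_t` for the solution. -/
theorem exists_absDPow_timeDeriv_decay (n : ℕ) {γ s : ℝ} (hγ : 1 < γ) (hs : 0 ≤ s) :
    ∃ C : ℝ, 0 < C ∧ ∀ u₀ u₁ : L2 n, MemHs s u₀ → MemL11 u₀ → MemHs s u₁ → MemL11 u₁ →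
      ∀ t : ℝ, 0 ≤ t → ∃ w : L2 n, IsAbsDPow s (timeDeriv (solution γ u₀ u₁) t) w ∧
        ‖w‖ ≤ C * ((1 + t) ^ (-((s + 2) / 2) - (n : ℝ) / 4) * normHsL11 s u₀
          + (1 + t) ^ (-((s + 1) / 2) - (n : ℝ) / 4) * ‖mean u₀‖
          + (1 + t) ^ (-((s + 1) / 2) - (n : ℝ) / 4) * normHsL11 s u₁
          + (1 + t) ^ (-(s / 2) - (n : ℝ) / 4) * ‖mean u₁‖) := by
  have hk0 : 0 < 1 - γ⁻¹ := by have := inv_lt_one_of_one_lt₀ hγ; linarith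
  have hc0 : 0 < (1 - γ⁻¹) / 4 := by positivity
  obtain ⟨A, hA0, hA⟩ := exists_rpow_le_mul_exp hc0 (s + 2 + (n : ℝ) / 2)
  have hQ : (0 : ℝ) ≤ (2 * Real.pi) ^ (2 * s) := by positivity
  have he : 0 ≤ 16 * Real.exp ((1 - γ⁻¹) / 4) := by positivity
  -- The statement of `hM` spells out the constant of `weighted_sq_sum_le`; the witness left as `_`
  -- below is read off from it.
  have hM := le_add_of_nonneg_left (a := (1 : ℝ)) (add_nonneg
    (mul_nonneg he (add_nonneg (add_nonneg (gaussMoment_nonneg n ((1 - γ⁻¹) / 4) (2 * s))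
      (gaussMoment_nonneg n ((1 - γ⁻¹) / 4) (2 * s + 2)))
      (gaussMoment_nonneg n ((1 - γ⁻¹) / 4) (2 * s + 4))))
    (mul_nonneg (mul_nonneg (by norm_num : (0 : ℝ) ≤ 34) hA0.le) hQ))
  refine ⟨_, lt_of_lt_of_le one_pos hM, fun u₀ u₁ h₀ l₀ h₁ l₁ t ht => ?_⟩
  obtain ⟨w, hw, hle⟩ := exists_absDPow_timeDeriv hγ hs h₀ l₀ h₁ l₁ ht
  obtain ⟨hαβ, hE, eα, eβ, eδ⟩ := decay_rates (n : ℝ) hA ht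
  have hT : 0 < 1 + t := by linarith
  rw [gaussMoment_mul _ hT, gaussMoment_mul _ hT, gaussMoment_mul _ hT, eα, eβ, eδ] at hle
  have hα : 0 ≤ (1 + t) ^ (-((s + 2) / 2) - (n : ℝ) / 4) := Real.rpow_nonneg hT.le _
  have hβ : 0 ≤ (1 + t) ^ (-((s + 1) / 2) - (n : ℝ) / 4) := Real.rpow_nonneg hT.le _
  have hδ : 0 ≤ (1 + t) ^ (-(s / 2) - (n : ℝ) / 4) := Real.rpow_nonneg hT.le _
  have hfin := hle.trans (weighted_sq_sum_le he hA0.le hQ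
    (gaussMoment_nonneg n ((1 - γ⁻¹) / 4) (2 * s))
    (gaussMoment_nonneg n ((1 - γ⁻¹) / 4) (2 * s + 2))
    (gaussMoment_nonneg n ((1 - γ⁻¹) / 4) (2 * s + 4)) hα hβ hδ hαβ hE
    (norm_nonneg _) (norm_nonneg _) (normL11_nonneg _) (normL11_nonneg _) (normHs_nonneg s _)
    (normHs_nonneg s _))
  refine ⟨w, hw, le_mul_of_sq_le hM ?_ hfin⟩
  have hn₀ : 0 ≤ normHsL11 s u₀ := add_nonneg (normHs_nonneg s u₀) (normL11_nonneg u₀)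
  have hn₁ : 0 ≤ normHsL11 s u₁ := add_nonneg (normHs_nonneg s u₁) (normL11_nonneg u₁)
  positivity

end ViscoelasticMemory

theorem mainTheorem6 (n : ℕ) (hn : 1 ≤ n) (γ : ℝ) (hγ : 1 < γ) (s : ℝ) (hs : 0 ≤ s) :
    ∃ C : ℝ, 0 < C ∧ ∀ u₀ u₁ : ViscoelasticMemory.L2 n,
      ViscoelasticMemory.MemHs s u₀ → ViscoelasticMemory.MemL11 u₀ →
      ViscoelasticMemory.MemHs s u₁ → ViscoelasticMemory.MemL11 u₁ →
      ∃ u : ℝ → ViscoelasticMemory.L2 n,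
        ViscoelasticMemory.IsSolution γ u₀ u₁ u ∧
        (∀ v : ℝ → ViscoelasticMemory.L2 n,
          ViscoelasticMemory.IsSolution γ u₀ u₁ v → Set.EqOn v u (Set.Ici 0)) ∧
        ∀ t : ℝ, 0 ≤ t → ∃ w : ViscoelasticMemory.L2 n,
          ViscoelasticMemory.IsAbsDPow s (ViscoelasticMemory.timeDeriv u t) w ∧
          ‖w‖ ≤ C *
            ((1 + t) ^ (-((s + 2) / 2) - (n : ℝ) / 4) * ViscoelasticMemory.normHsL11 s u₀
              + (1 + t) ^ (-((s + 1) / 2) - (n : ℝ) / 4) * ‖ViscoelasticMemory.mean u₀‖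
              + (1 + t) ^ (-((s + 1) / 2) - (n : ℝ) / 4) * ViscoelasticMemory.normHsL11 s u₁
              + (1 + t) ^ (-(s / 2) - (n : ℝ) / 4) * ‖ViscoelasticMemory.mean u₁‖) := by
  obtain ⟨C, hC, h⟩ := ViscoelasticMemory.exists_absDPow_timeDeriv_decay n hγ hs
  exact ⟨C, hC, fun u₀ u₁ h₀ l₀ h₁ l₁ => ⟨ViscoelasticMemory.solution γ u₀ u₁,
    ViscoelasticMemory.isSolution_solution hγ u₀ u₁,
    fun v hv => ViscoelasticMemory.IsSolution.eqOn (by linarith)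
      (ViscoelasticMemory.isSolution_solution hγ u₀ u₁) hv,
    h u₀ u₁ h₀ l₀ h₁ l₁⟩⟩
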